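/- Let $X$ be a disjoint union of finitely many tetrahedra whose codimension-1 faces are identified in pairs by affine homeomorphisms, and let $(M,\mathbf T)$ be the quotient, a triangulated closed pseudo 3-manifold. A normal arc is an embedded arc in a triangular face, with interior in the interior of the face, whose end points lie in the interiors of two different edges of the face. A normal triangle (normal quadrilateral) is a properly embedded closed disk in a tetrahedron whose boundary consists of three (four) normal arcs lying in different faces. Each tetrahedron has four normal triangle types (one for each vertex cut off) and three normal quadrilateral types (one for each pair of opposite edges from which the quadrilateral is disjoint). Let $\triangle$ and $\Box$ be the sets of all triangle types and quadrilateral types of $\mathbf T$, and let $T$ and $E$ be the sets of tetrahedra and of edges of $\mathbf T$ (an edge of $\mathbf T$ is a class of edges of tetrahedra under the identifications). For $q\in\Box$, $e\in E$, let $i(q,e)$ be the number of edges of tetrahedra that represent $e$, lie in the same tetrahedron as $q$, and are disjoint from $q$. Let $TAS(\mathbf T)\subset\mathbb R^{\Box}$ be the space of all $x$ with $\sum_{q\subset\sigma}x(q)=0$ for every $\sigma\in T$ and $\sum_{q\in\Box}i(q,e)x(q)=0$ for every $e\in E$. Call $(M,\mathbf T)$ angle rigid if there is $q\in\Box$ with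 $x(q)=0$ for all $x\in TAS(\mathbf T)$, and 2-angle rigid if there are $(c_1,c_2)\in\mathbb R^2\setminus\{0\}$ and $q_1\ne q_2$ in $\Box$ with $c_1x(q_1)+c_2x(q_2)=0$ for all $x\in TAS(\mathbf T)$. Let $\mathbf S_{ns}\subset\mathbb R^{\triangle}\times\mathbb R^{\Box}$ be the solution space of the normal surface equations: for each normal arc type $a$ in a face of $\mathbf T$, $x(t)+x(q)=x(t')+x(q')$, where $t,q$ and $t',q'$ are the triangle and quadrilateral types having $a$ as an edge on the two sides of the face. An embedded normal surface is a subset $\Sigma\subset M$ whose preimage in each tetrahedron of $X$ is a union of finitely many pairwise disjoint normal disks (normal triangles or quadrilaterals). **Corollary 2.4.** (a) $(M,\mathbf T)$ is angle rigid if and only if there is an embedded normal surface $\Sigma$ in $(M,\mathbf T)$ such that exactly one normal quadrilateral type occurs among its normal disks. (b) $(M,\mathbf T)$ is 2-angle rigid if and only if there is $v\in\mathbf S_{ns}\cap(\mathbb Z^{\triangle}\times\mathbb Z^{\Box})$ whose projection to $\mathbb R^{\Box}$ is non-zero and has at most two non-zero coordinates. -/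

import Mathlib

namespace NormalSurfaces

noncomputable section

/- ### The standard tetrahedron and its normal disks -/

/-- The tetrahedron, with vertices `0, 1, 2, 3`, in barycentric coordinates. -/
abbrev Tetrahedron : Type := stdSimplex ℝ (Fin 4)

/-- The closed triangular face opposite to the vertex `f`. -/
def face (f : Fin 4) : Set Tetrahedron := {x | x.1 f = 0}

/-- The interior of the triangular face opposite to the vertex `f`. -/
def openFace (f : Fin 4) : Set Tetrahedron := {x | ∀ k, x.1 k = 0 ↔ k = f}

/-- The boundary sphere of the tetrahedron. -/
def boundary : Set Tetrahedron := ⋃ f, face f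

/-- The closed edge joining the vertices `i ≠ j`. -/
def edge (i j : Fin 4) : Set Tetrahedron := {x | ∀ k, k ≠ i → k ≠ j → x.1 k = 0}

/-- The interior of the edge joining the vertices `i ≠ j`. -/
def openEdge (i j : Fin 4) : Set Tetrahedron := {x | ∀ k, x.1 k ≠ 0 ↔ k = i ∨ k = j}

/-- `A` is a normal arc in the face opposite to `f`: an embedded arc whose interior lies in the
interior of that face and whose end points lie in (the interiors of) two different edges
`{v, w}` and `{v, u}` of that face. (Two different edges of a triangle share one vertex `v`.) -/
def IsNormalArc (f : Fin 4) (A : Set Tetrahedron) : Prop :=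
  ∃ v w u : Fin 4, v ≠ f ∧ w ≠ f ∧ u ≠ f ∧ v ≠ w ∧ v ≠ u ∧ w ≠ u ∧
    ∃ γ : C(unitInterval, Tetrahedron), Function.Injective γ ∧ Set.range γ = A ∧
      γ 0 ∈ openEdge v w ∧ γ 1 ∈ openEdge v u ∧
      ∀ t : unitInterval, t ≠ 0 → t ≠ 1 → γ t ∈ openFace f

/-- `D` is a properly embedded closed disk in the tetrahedron whose boundary circle (which is
`D ∩ boundary`) consists of exactly `n` normal arcs, lying in different faces. -/
def IsNormalPolygon (n : ℕ) (D : Set Tetrahedron) : Prop :=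
  (∃ φ : C(Metric.closedBall (0 : EuclideanSpace ℝ (Fin 2)) 1, Tetrahedron),
    Function.Injective φ ∧ Set.range φ = D ∧
      ∀ p, φ p ∈ boundary ↔ ‖(p : EuclideanSpace ℝ (Fin 2))‖ = 1) ∧
  ∃ F : Finset (Fin 4), F.card = n ∧
    (∀ f ∈ F, IsNormalArc f (D ∩ face f)) ∧ ∀ f ∉ F, D ∩ face f = ∅

/-- Normal triangles. -/
def IsNormalTriangle (D : Set Tetrahedron) : Prop := IsNormalPolygon 3 D

/-- Normal quadrilaterals. -/
def IsNormalQuadrilateral (D : Set Tetrahedron) : Prop := IsNormalPolygon 4 D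

/-- Normal disks. -/
def IsNormalDisk (D : Set Tetrahedron) : Prop := IsNormalTriangle D ∨ IsNormalQuadrilateral D

/-- A quadrilateral type in a tetrahedron is a pair of opposite edges, namely the two edges from
which the quadrilateral is disjoint. Such a pair is encoded by the fixed-point free involution
`p` of the vertices that exchanges the end points of each of the two edges; the edges are the
`{i, p i}`. There are three types. -/
abbrev QuadType : Type := {p : Equiv.Perm (Fin 4) // ∀ i, p i ≠ i ∧ p (p i) = i}

/-- `D` is a normal quadrilateral of type `p`: it is disjoint from the edges `{i, p i}`. -/
def IsNormalQuadOfType (p : QuadType) (D : Set Tetrahedron) : Prop :=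
  IsNormalQuadrilateral D ∧ ∀ i, D ∩ edge i (p.1 i) = ∅

/-- The six edges of a tetrahedron, as two-element sets of vertices. -/
abbrev TetEdge : Type := {s : Finset (Fin 4) // s.card = 2}

/-- The image of an edge under a relabelling of the vertices. -/
def TetEdge.map (g : Equiv.Perm (Fin 4)) (s : TetEdge) : TetEdge :=
  ⟨s.1.map g.toEmbedding, by rw [Finset.card_map]; exact s.2⟩

/- ### Triangulated closed pseudo 3-manifolds -/

/-- A triangulated closed pseudo 3-manifold: the codimension-1 faces of tetrahedra indexed by
`T` are identified in pairs by affine homeomorphisms (`T` is assumed finite wherever this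
matters). The face of `σ` opposite to `f` is glued to the face of `nbr σ f` opposite to
`perm σ f f` by the affine map that sends the vertex `k ≠ f` to the vertex `perm σ f k`.
Neither orientability nor connectedness is required, and tetrahedra may be glued to
themselves. -/
structure Triangulation (T : Type*) where
  /-- the tetrahedron on the other side of a face -/
  nbr : T → Fin 4 → T
  /-- the gluing map of a face, on vertices -/
  perm : T → Fin 4 → Equiv.Perm (Fin 4)
  /-- gluing is symmetric -/
  nbr_nbr : ∀ σ f, nbr (nbr σ f) (perm σ f f) = σ
  /-- the gluing map from the other side is the inverse map -/
  perm_nbr : ∀ σ f, perm (nbr σ f) (perm σ f f) = (perm σ f)⁻¹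
  /-- no face is glued to itself -/
  ne_self : ∀ σ f, (nbr σ f, perm σ f f) ≠ (σ, f)

namespace Triangulation

variable {T : Type*} (G : Triangulation T)

/-- Face identification of points of the disjoint union `T × Tetrahedron`. -/
def PointRel (a b : T × Tetrahedron) : Prop :=
  ∃ f, a.2 ∈ face f ∧ b.1 = G.nbr a.1 f ∧ ∀ k, b.2.1 (G.perm a.1 f k) = a.2.1 k

/-- The underlying quotient space `M`. -/
def Space : Type _ := Quot G.PointRel

/-- The quotient topology on `M`. -/
instance : TopologicalSpace G.Space :=
  letI : TopologicalSpace T := ⊥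
  inferInstanceAs (TopologicalSpace (Quot G.PointRel))

/-- The characteristic map of the tetrahedron `σ`. -/
def toSpace (σ : T) (x : Tetrahedron) : G.Space := Quot.mk _ (σ, x)

/-- Identification of the edges of the tetrahedra (generating relation). -/
def EdgeRel (a b : T × TetEdge) : Prop :=
  ∃ f, f ∉ a.2.1 ∧ b.1 = G.nbr a.1 f ∧ b.2 = a.2.map (G.perm a.1 f)

/-- The set `E` of edges of the triangulation. -/
def Edge : Type _ := Quot G.EdgeRel

/-- The edge of the triangulation represented by an edge of a tetrahedron. -/
def edgeClass (a : T × TetEdge) : G.Edge := Quot.mk _ a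

/-- An embedded (closed) normal surface: a subset `carrier` of `M` that meets each tetrahedron in
finitely many pairwise disjoint normal disks. The disks are the connected components of the
part of the surface in the tetrahedron, so they are determined by `carrier`. (Such a subset
is automatically a closed surface: each normal arc in a face bounds exactly one disk on each of
the two sides of the face, and the disk corners at a point on an edge form a cycle.) -/
structure EmbeddedNormalSurface where
  /-- the surface as a subset of `M` -/
  carrier : Set G.Space
  /-- the normal disks in each tetrahedron -/
  disks : T → Set (Set Tetrahedron)
  finite_disks : ∀ σ, (disks σ).Finite
  isNormalDisk : ∀ σ, ∀ D ∈ disks σ, IsNormalDisk D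
  pairwise_disjoint : ∀ σ, (disks σ).PairwiseDisjoint id
  sUnion_disks : ∀ σ, ⋃₀ disks σ = G.toSpace σ ⁻¹' carrier

/-- The quadrilateral types that occur in an embedded normal surface. -/
def EmbeddedNormalSurface.quadTypes {G : Triangulation T} (S : G.EmbeddedNormalSurface) :
    Set (T × QuadType) :=
  {q | ∃ D ∈ S.disks q.1, IsNormalQuadOfType q.2 D}

/- ### Normal surface equation

The set of triangle types is `T × Fin 4`, where `(σ, v)` cuts off the vertex `v` of `σ`; the set
of quadrilateral types is `T × QuadType`. -/

/-- The total weight of the normal disk types having the following normal arc as an edge: the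
arc in the face of `σ` opposite to `f` that cuts off the vertex `v ≠ f` of this face. It is an
edge of the triangle at `v`, and of the quadrilateral `p` with `p f = v`: the latter is
disjoint from the edge of the face that is opposite to `v`. -/
def arcWeight (x : (T × Fin 4 → ℝ) × (T × QuadType → ℝ)) (σ : T) (f v : Fin 4) : ℝ :=
  x.1 (σ, v) + ∑ p : QuadType with p.1 f = v, x.2 (σ, p)

/-- The space of solutions of the normal surface equation: for each normal arc, the weights of
the disk types on the two sides of the face that contains it agree. -/
def normalSurfaceSpace : Submodule ℝ ((T × Fin 4 → ℝ) × (T × QuadType → ℝ)) where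
  carrier := {x | ∀ σ f v, v ≠ f →
    arcWeight x σ f v = arcWeight x (G.nbr σ f) (G.perm σ f f) (G.perm σ f v)}
  zero_mem' := by simp [arcWeight]
  add_mem' := by
    intro x y hx hy σ f v hv
    have h1 := hx σ f v hv
    have h2 := hy σ f v hv
    simp only [arcWeight, Prod.fst_add, Prod.snd_add, Pi.add_apply,
      Finset.sum_add_distrib] at h1 h2 ⊢
    linarith
  smul_mem' := by
    intro c x hx σ f v hv
    have h1 := hx σ f v hv
    simp only [arcWeight, Prod.smul_fst, Prod.smul_snd, Pi.smul_apply, smul_eq_mul,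
      ← Finset.mul_sum, ← mul_add] at h1 ⊢
    rw [h1]

/- ### Tangential angle structures and rigidity -/

open Classical in
/-- The index of an edge of a tetrahedron and a quadrilateral type: `1` if both lie in the same
tetrahedron and are disjoint, `0` otherwise. -/
def tetIndex (a : T × TetEdge) (q : T × QuadType) : ℕ :=
  if a.1 = q.1 ∧ ∃ i, a.2.1 = {i, q.2.1 i} then 1 else 0

variable [Fintype T]

open Classical in
/-- The index `i(q, e)`: the sum of the indices of the representatives of `e`. -/
def index (q : T × QuadType) (e : G.Edge) : ℕ :=
  ∑ a : T × TetEdge with G.edgeClass a = e, tetIndex a q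

/-- The space of tangential angle structures. -/
def TAS : Submodule ℝ (T × QuadType → ℝ) where
  carrier := {x | (∀ σ, ∑ p : QuadType, x (σ, p) = 0) ∧
    ∀ e : G.Edge, ∑ q : T × QuadType, (G.index q e : ℝ) * x q = 0}
  zero_mem' := by simp
  add_mem' := by
    rintro x y ⟨hx, hx'⟩ ⟨hy, hy'⟩
    refine ⟨fun σ => ?_, fun e => ?_⟩
    · simp [Finset.sum_add_distrib, hx σ, hy σ]
    · simp [mul_add, Finset.sum_add_distrib, hx' e, hy' e]
  smul_mem' := by
    rintro c x ⟨hx, hx'⟩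
    refine ⟨fun σ => ?_, fun e => ?_⟩
    · simp [← Finset.mul_sum, hx σ]
    · simp only [Pi.smul_apply, smul_eq_mul, mul_left_comm _ c, ← Finset.mul_sum, hx' e,
        mul_zero]

/-- Angle rigidity: some quadrilateral has zero angle in all tangential angle structures. -/
def AngleRigid : Prop := ∃ q : T × QuadType, ∀ x ∈ G.TAS, x q = 0

/-- 2-angle rigidity. -/
def TwoAngleRigid : Prop :=
  ∃ c₁ c₂ : ℝ, (c₁, c₂) ≠ (0, 0) ∧ ∃ q₁ q₂ : T × QuadType, q₁ ≠ q₂ ∧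
    ∀ x ∈ G.TAS, c₁ * x q₁ + c₂ * x q₂ = 0

end Triangulation

end

end NormalSurfaces

/-!
The proof rests on the duality `forall_mem_TAS_iff_exists_mem`: the orthogonal complement of the
space of tangential angle structures is the projection of the space of solutions of the normal
surface equation to the quadrilateral coordinates. Indeed this complement is spanned by the
tetrahedron equations and the edge equations, so it consists of the vectors
`q ↦ c σ - (w e + w e') / 2`, where `q` is a quadrilateral type in `σ`, `e` and `e'` are the two
edges of `σ` disjoint from `q`, and `w` and `c` are arbitrary functions on the edges and the
tetrahedra (`quadCoord`). A solution of the normal surface equation has this form, with `w` the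
number of points on the edges (`exists_quadCoord_of_mem`). Conversely, the numbers of points on the
edges of a face determine the weights of its arcs, and this extends every such vector to a solution
(`exists_mem_of_quadCoord`).

Consequently, rigidity says that there is a real solution whose quadrilateral part is non-zero and
supported on one or two types. A `ℚ`-linear functional on `ℝ` turns it into a rational solution
with no larger support, and clearing denominators into an integral one (`exists_int_mem`). This
proves the statement about 2-angle rigidity.

For angle rigidity, the integral solution is made non-negative by adding vertex links, and is then
realized by an embedded surface (`exists_surface`). In each tetrahedron the disks are plane
sections through equally spaced points on the edges. Since only one quadrilateral type occurs, the
four corners of each quadrilateral are coplanar and the planes do not cross inside the tetrahedron;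
the trace of the disks on a face is determined by the numbers of arcs in the face
(`mem_sUnion_modelDisks_iff`), so the disks match along the faces.

Conversely, let `w` count the points of an arbitrary embedded normal surface on the edges. The arcs
of a normal disk alone determine which edges it meets, and that it meets each of them once. Hence
the numbers of quadrilaterals of the various types are `quadCoord w c` for a suitable `c`
(`exists_quadCoord_edgeWeight`), and they are orthogonal to all tangential angle structures. No
matching of arcs across faces is needed here.
-/

namespace NormalSurfaces

/-! ### Quadrilateral types and edges of a tetrahedron -/

section
set_option maxRecDepth 100000

theorem QuadType.exists_apply_eq : ∀ f v : Fin 4, v ≠ f → ∃ p : QuadType, p.1 f = v := by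
  decide

theorem QuadType.eq_of_apply_eq : ∀ (p q : QuadType) (i : Fin 4), p.1 i = q.1 i → p = q := by
  decide

theorem QuadType.apply_ne (p : QuadType) (i : Fin 4) : p.1 i ≠ i := (p.2 i).1

theorem QuadType.apply_apply (p : QuadType) (i : Fin 4) : p.1 (p.1 i) = i := (p.2 i).2

theorem eq_or_eq_of_distinct : ∀ {a b c d : Fin 4}, a ≠ b → a ≠ c → a ≠ d → b ≠ c → b ≠ d →
    c ≠ d → ∀ x, x = a ∨ x = b ∨ x = c ∨ x = d := by
  decide

theorem exists_distinct : ∀ {a b : Fin 4}, a ≠ b → ∃ c d : Fin 4,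
    a ≠ c ∧ a ≠ d ∧ b ≠ c ∧ b ≠ d ∧ c ≠ d := by
  decide

theorem QuadType.card_filter_eq_pair : ∀ (p : QuadType) (s : Finset (Fin 4)), s.card = 2 →
    (Finset.univ.filter fun i => s = {i, p.1 i}).card = if ∃ i, s = {i, p.1 i} then 2 else 0 := by
  decide

theorem QuadType.apply_mem_iff : ∀ (p : QuadType) (s : Finset (Fin 4)), s.card = 2 →
    ∀ f ∉ s, (p.1 f ∈ s ↔ ¬ ∃ i, s = {i, p.1 i}) := by
  decide

theorem QuadType.exists_pair_eq_iff : ∀ (p q : QuadType) (j : Fin 4),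
    (∃ i, ({j, p.1 j} : Finset (Fin 4)) = {i, q.1 i}) ↔ q = p := by
  decide

end

theorem QuadType.card_pair (p : QuadType) (i : Fin 4) : ({i, p.1 i} : Finset (Fin 4)).card = 2 :=
  Finset.card_pair (p.apply_ne i).symm

theorem sum_fin_four {M : Type*} [AddCommMonoid M] {a b c d : Fin 4} (hab : a ≠ b) (hac : a ≠ c)
    (had : a ≠ d) (hbc : b ≠ c) (hbd : b ≠ d) (hcd : c ≠ d) (h : Fin 4 → M) :
    ∑ i, h i = h a + (h b + (h c + h d)) := by
  have : (Finset.univ : Finset (Fin 4)) = {a, b, c, d} := by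
    ext x
    simpa using eq_or_eq_of_distinct hab hac had hbc hbd hcd x
  rw [this, Finset.sum_insert (by simp [*]), Finset.sum_insert (by simp [*]),
    Finset.sum_insert (by simp [*]), Finset.sum_singleton]

/-- Exactly one quadrilateral type has a given arc as an edge. -/
theorem QuadType.filter_apply_eq {p : QuadType} {f v : Fin 4} (h : p.1 f = v) :
    (Finset.univ.filter fun q : QuadType => q.1 f = v) = {p} := by
  ext q
  simp only [Finset.mem_filter, Finset.mem_univ, true_and, Finset.mem_singleton]
  constructor
  · intro hq
    exact QuadType.eq_of_apply_eq q p f (hq.trans h.symm)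
  · rintro rfl
    exact h

/-! ### Solutions of the normal surface equation from weights of edges -/

namespace Triangulation

variable {T : Type*} (G : Triangulation T)

open Classical in
/-- A function on the edges of the triangulation, as a function on the sets of vertices of each
tetrahedron; its value is `0` on sets that do not consist of two vertices. -/
noncomputable def edgeLift (w : G.Edge → ℝ) (σ : T) (s : Finset (Fin 4)) : ℝ :=
  if h : s.card = 2 then w (G.edgeClass (σ, ⟨s, h⟩)) else 0

variable {G} in
theorem edgeLift_nbr (w : G.Edge → ℝ) (σ : T) {f : Fin 4} {s : Finset (Fin 4)} (hf : f ∉ s) :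
    G.edgeLift w (G.nbr σ f) (s.map (G.perm σ f).toEmbedding) = G.edgeLift w σ s := by
  unfold edgeLift
  by_cases h : s.card = 2
  · rw [dif_pos h, dif_pos (by rwa [Finset.card_map])]
    congr 1
    exact (Quot.sound ⟨f, hf, rfl, rfl⟩).symm
  · rw [dif_neg h, dif_neg (by rwa [Finset.card_map])]

/-- The quadrilateral coordinates determined by weights `w` of edges and `c` of tetrahedra. As the
sum over `i` meets both edges `{i, p i}` disjoint from the quadrilateral twice, this is
`c σ - (w e + w e') / 2` for these edges `e` and `e'`. -/
noncomputable def quadCoord (w : G.Edge → ℝ) (c : T → ℝ) (q : T × QuadType) : ℝ :=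
  c q.1 - (∑ i, G.edgeLift w q.1 {i, q.2.1 i}) / 4

variable {G}

/-- If `w` counts the points of a normal surface on the edges, then `quadCoord w c` are its
quadrilateral coordinates, where `c σ` is half the number of triangles plus the number of
quadrilaterals in `σ`. -/
theorem exists_quadCoord_of_mem {v : (T × Fin 4 → ℝ) × (T × QuadType → ℝ)}
    (hv : v ∈ G.normalSurfaceSpace) : ∃ w c, v.2 = G.quadCoord w c := by
  -- The number of points on an edge, read off in one of the tetrahedra that contain it.
  let W : T × TetEdge → ℝ := fun a =>
    ∑ i ∈ a.2.1, v.1 (a.1, i) + ∑ p : QuadType with ¬ ∃ i, a.2.1 = {i, p.1 i}, v.2 (a.1, p)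
  have hW : ∀ (a : T × TetEdge) (f : Fin 4), f ∉ a.2.1 →
      W a = ∑ i ∈ a.2.1, arcWeight v a.1 f i := by
    intro a f hf
    simp only [W, arcWeight, Finset.sum_add_distrib]
    congr 1
    simp only [Finset.sum_filter]
    rw [Finset.sum_comm]
    refine Finset.sum_congr rfl fun p _ => ?_
    rw [Finset.sum_ite_eq]
    simp only [QuadType.apply_mem_iff p a.2.1 a.2.2 f hf]
  have hrel : ∀ a b : T × TetEdge, G.EdgeRel a b → W a = W b := by
    rintro ⟨σ, s⟩ ⟨τ, s'⟩ ⟨f, hf, h1, h2⟩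
    dsimp only at hf h1 h2
    subst h1 h2
    rw [hW _ f hf, hW _ (G.perm σ f f) (by simpa [TetEdge.map] using hf)]
    simp only [TetEdge.map, Finset.sum_map, Equiv.coe_toEmbedding]
    refine Finset.sum_congr rfl fun i hi => hv σ f i ?_
    rintro rfl
    exact hf hi
  refine ⟨Quot.lift W hrel, fun σ => ∑ p, v.2 (σ, p) + (∑ i, v.1 (σ, i)) / 2, ?_⟩
  funext ⟨σ, p⟩
  have hlift : ∀ i, G.edgeLift (Quot.lift W hrel) σ {i, p.1 i} =
      v.1 (σ, i) + v.1 (σ, p.1 i) + ((∑ p, v.2 (σ, p)) - v.2 (σ, p)) := by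
    intro i
    refine (dif_pos (p.card_pair i)).trans ?_
    change W _ = _
    simp only [W, QuadType.exists_pair_eq_iff, Finset.sum_pair (p.apply_ne i).symm]
    congr 1
    rw [← Finset.sum_filter_add_sum_filter_not Finset.univ (fun p' => p' = p),
      Finset.filter_eq', if_pos (Finset.mem_univ p), Finset.sum_singleton, add_sub_cancel_left]
  simp only [quadCoord, hlift, Finset.sum_add_distrib, Equiv.sum_comp p.1 fun i => v.1 (σ, i)]
  simp
  ring

/-- Conversely, arbitrary weights of edges and tetrahedra determine a solution of the normal
surface equation: in a face with vertices `v, x, y`, the weight of the arc that cuts off `v` has to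
be `(w {v, x} + w {v, y} - w {x, y}) / 2`, which depends only on the face. -/
theorem exists_mem_of_quadCoord (w : G.Edge → ℝ) (c : T → ℝ) :
    ∃ v ∈ G.normalSurfaceSpace, v.2 = G.quadCoord w c := by
  let v : (T × Fin 4 → ℝ) × (T × QuadType → ℝ) :=
    ⟨fun t => (∑ j, G.edgeLift w t.1 {t.2, j}) / 2 - c t.1, G.quadCoord w c⟩
  have harc : ∀ σ {f x y z : Fin 4}, f ≠ x → f ≠ y → f ≠ z → x ≠ y → x ≠ z → y ≠ z →
      arcWeight v σ f x = (G.edgeLift w σ {x, y} + G.edgeLift w σ {x, z}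
        - G.edgeLift w σ {y, z}) / 2 := by
    intro σ f x y z hfx hfy hfz hxy hxz hyz
    obtain ⟨p, hp⟩ := QuadType.exists_apply_eq f x hfx.symm
    have hp' : p.1 x = f := by rw [← hp, p.apply_apply]
    have hpy : p.1 y = z := by
      rcases eq_or_eq_of_distinct hfx hfy hfz hxy hxz hyz (p.1 y) with h | h | h | h
      · exact absurd (p.1.injective (h.trans hp'.symm)) hxy.symm
      · exact absurd (p.1.injective (h.trans hp.symm)) hfy.symm
      · exact absurd h (p.apply_ne y)
      · exact h
    have hpz : p.1 z = y := by rw [← hpy, p.apply_apply]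
    have hsing : G.edgeLift w σ {x, x} = 0 := by simp [edgeLift]
    simp only [arcWeight, QuadType.filter_apply_eq hp, Finset.sum_singleton, v, quadCoord]
    rw [sum_fin_four hfx hfy hfz hxy hxz hyz, sum_fin_four hfx hfy hfz hxy hxz hyz,
      hp, hp', hpy, hpz, Finset.pair_comm z y, Finset.pair_comm f x, hsing]
    ring
  refine ⟨v, fun σ f x hx => ?_, rfl⟩
  obtain ⟨y, z, hfy, hfz, hxy, hxz, hyz⟩ := exists_distinct hx.symm
  have inj := (G.perm σ f).injective
  rw [harc σ hx.symm hfy hfz hxy hxz hyz, harc (G.nbr σ f) (inj.ne hx.symm) (inj.ne hfy)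
    (inj.ne hfz) (inj.ne hxy) (inj.ne hxz) (inj.ne hyz),
    ← edgeLift_nbr w σ (f := f) (s := {x, y}) (by simp [*, hx.symm]),
    ← edgeLift_nbr w σ (f := f) (s := {x, z}) (by simp [*, hx.symm]),
    ← edgeLift_nbr w σ (f := f) (s := {y, z}) (by simp [*])]
  simp

/-! ### Duality between tangential angle structures and normal surfaces -/

variable [Fintype T]

theorem sum_index_mul (w : G.Edge → ℝ) [Fintype G.Edge] (q : T × QuadType) :
    ∑ e, w e * (G.index q e : ℝ) = (∑ i, G.edgeLift w q.1 {i, q.2.1 i}) / 2 := by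
  classical
  have h1 : ∑ e, w e * (G.index q e : ℝ) =
      ∑ a : T × TetEdge, w (G.edgeClass a) * (tetIndex a q : ℝ) := by
    simp only [index, Nat.cast_sum, Finset.mul_sum]
    rw [← Finset.sum_fiberwise Finset.univ G.edgeClass]
    refine Finset.sum_congr rfl fun e _ => ?_
    refine Finset.sum_congr (by congr) fun a ha => ?_
    rw [(Finset.mem_filter.1 ha).2]
  have h2 : ∀ i, G.edgeLift w q.1 {i, q.2.1 i} =
      ∑ s : TetEdge, if s.1 = {i, q.2.1 i} then w (G.edgeClass (q.1, s)) else 0 := by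
    intro i
    rw [edgeLift, dif_pos (q.2.card_pair i),
      Finset.sum_eq_single (⟨{i, q.2.1 i}, q.2.card_pair i⟩ : TetEdge)]
    · simp
    · intro s _ hs
      exact if_neg fun h => hs (Subtype.ext h)
    · simp
  rw [h1, Fintype.sum_prod_type, Finset.sum_eq_single q.1]
  · simp only [h2]
    rw [Finset.sum_comm, Finset.sum_div]
    refine Finset.sum_congr rfl fun s _ => ?_
    rw [← Finset.sum_filter, Finset.sum_const]
    have := QuadType.card_filter_eq_pair q.2 s.1 s.2
    rw [this]
    by_cases h : ∃ i, s.1 = {i, q.2.1 i}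
    · simp [tetIndex, h]
    · simp [tetIndex, h]
  · intro σ _ hσ
    simp [tetIndex, hσ]
  · simp

/-- The tetrahedron and edge equations, which define the space of tangential angle structures,
span exactly the vectors `quadCoord w c`. -/
theorem forall_mem_TAS_iff (u : T × QuadType → ℝ) :
    (∀ x ∈ G.TAS, ∑ q, u q * x q = 0) ↔ ∃ w c, u = G.quadCoord w c := by
  classical
  have : Finite G.Edge := inferInstanceAs (Finite (Quot G.EdgeRel))
  have := Fintype.ofFinite G.Edge
  constructor
  · intro h
    let pair : (T × QuadType → ℝ) → Module.Dual ℝ (T × QuadType → ℝ) :=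
      fun y => Fintype.linearCombination ℝ y
    have hpair : ∀ y x, pair y x = ∑ q, x q * y q := fun y x => by
      simp [pair, Fintype.linearCombination_apply]
    have hsingle : ∀ y q, pair y (Pi.single q 1) = y q := fun y q => by
      simp [hpair, Pi.single_apply]
    let L : T ⊕ G.Edge → Module.Dual ℝ (T × QuadType → ℝ) :=
      Sum.elim (fun σ => pair fun q => if q.1 = σ then 1 else 0)
        (fun e => pair fun q => (G.index q e : ℝ))
    have key : pair u ∈ Submodule.span ℝ (Set.range L) := by
      refine mem_span_of_iInf_ker_le_ker fun x hx => ?_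
      rw [LinearMap.mem_ker, hpair, ← h x]
      · exact Finset.sum_congr rfl fun _ _ => mul_comm _ _
      rw [Submodule.mem_iInf] at hx
      refine ⟨fun σ => ?_, fun e => ?_⟩
      · have := hx (Sum.inl σ)
        simp only [L, Sum.elim_inl, LinearMap.mem_ker, hpair, mul_ite, mul_one, mul_zero] at this
        rw [Fintype.sum_prod_type, Finset.sum_eq_single σ] at this
        · simpa using this
        · intro τ _ hτ
          simp [hτ]
        · simp
      · have := hx (Sum.inr e)
        simp only [L, Sum.elim_inr, LinearMap.mem_ker, hpair] at this
        rw [← this]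
        exact Finset.sum_congr rfl fun _ _ => mul_comm _ _
    obtain ⟨a, ha⟩ := (Submodule.mem_span_range_iff_exists_fun ℝ).1 key
    refine ⟨fun e => -2 * a (Sum.inr e), fun σ => a (Sum.inl σ), funext fun q => ?_⟩
    have hq := LinearMap.congr_fun ha (Pi.single q 1)
    simp only [L, LinearMap.add_apply, LinearMap.sum_apply, LinearMap.smul_apply,
      Fintype.sum_sum_type, Sum.elim_inl, Sum.elim_inr, hsingle, smul_eq_mul, mul_ite, mul_one,
      mul_zero, Finset.sum_ite_eq, Finset.mem_univ, if_true] at hq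
    have h2 := sum_index_mul (G := G) (fun e => -2 * a (Sum.inr e)) q
    simp only [mul_assoc, ← Finset.mul_sum] at h2
    rw [quadCoord, ← hq]
    linarith
  · rintro ⟨w, c, rfl⟩ x ⟨hx, hx'⟩
    have h1 : ∑ q : T × QuadType, c q.1 * x q = 0 := by
      rw [Fintype.sum_prod_type]
      simp [← Finset.mul_sum, hx]
    have h2 : ∑ q, (∑ i, G.edgeLift w q.1 {i, q.2.1 i}) / 2 * x q = 0 := by
      simp only [← sum_index_mul, Finset.sum_mul]
      rw [Finset.sum_comm]
      refine Finset.sum_eq_zero fun e _ => ?_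
      simp only [mul_assoc, ← Finset.mul_sum, hx' e, mul_zero]
    calc ∑ q, G.quadCoord w c q * x q
        = ∑ q : T × QuadType, c q.1 * x q
          - (∑ q, (∑ i, G.edgeLift w q.1 {i, q.2.1 i}) / 2 * x q) / 2 := by
          rw [Finset.sum_div, ← Finset.sum_sub_distrib]
          exact Finset.sum_congr rfl fun q _ => by rw [quadCoord]; ring
      _ = 0 := by rw [h1, h2]; simp

/-- The orthogonal complement of the space of tangential angle structures is the projection of
the space of solutions of the normal surface equation to the quadrilateral coordinates. -/
theorem forall_mem_TAS_iff_exists_mem (u : T × QuadType → ℝ) :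
    (∀ x ∈ G.TAS, ∑ q, u q * x q = 0) ↔ ∃ v ∈ G.normalSurfaceSpace, v.2 = u := by
  rw [forall_mem_TAS_iff]
  constructor
  · rintro ⟨w, c, rfl⟩
    exact exists_mem_of_quadCoord w c
  · rintro ⟨v, hv, rfl⟩
    exact exists_quadCoord_of_mem hv

/-! ### Integral solutions -/

/-- A solution of the normal surface equation gives an integral one: the equation has integral
coefficients, so it is preserved by `ℚ`-linear maps `ℝ → ℚ` applied to the coordinates, and
denominators can be cleared. -/
theorem exists_int_mem {v : (T × Fin 4 → ℝ) × (T × QuadType → ℝ)} (hv : v ∈ G.normalSurfaceSpace)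
    {q₀ : T × QuadType} (hq₀ : v.2 q₀ ≠ 0) :
    ∃ (t : T × Fin 4 → ℤ) (n : T × QuadType → ℤ),
      ((fun i => (t i : ℝ), fun q => (n q : ℝ)) : (T × Fin 4 → ℝ) × (T × QuadType → ℝ)) ∈
        G.normalSurfaceSpace ∧ 0 < n q₀ ∧ ∀ q, v.2 q = 0 → n q = 0 := by
  obtain ⟨φ, hφ⟩ : ∃ φ : Module.Dual ℚ ℝ, φ (v.2 q₀) ≠ 0 := by
    by_contra! h
    exact hq₀ ((Module.forall_dual_apply_eq_zero_iff ℚ _).1 h)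
  obtain ⟨b, hb⟩ := IsLocalization.exist_integer_multiples_of_finite (nonZeroDivisors ℤ)
    (Sum.elim (fun i => φ (v.1 i)) fun q => φ (v.2 q) : (T × Fin 4) ⊕ (T × QuadType) → ℚ)
  choose m hm using hb
  have hm1 : ∀ i, (m (Sum.inl i) : ℚ) = (b : ℤ) * φ (v.1 i) := fun i => by
    simpa using hm (Sum.inl i)
  have hm2 : ∀ q, (m (Sum.inr q) : ℚ) = (b : ℤ) * φ (v.2 q) := fun q => by
    simpa using hm (Sum.inr q)
  have hb0 : ((b : ℤ) : ℚ) ≠ 0 := by exact_mod_cast nonZeroDivisors.coe_ne_zero b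
  have hne : m (Sum.inr q₀) ≠ 0 := by
    have : (m (Sum.inr q₀) : ℚ) ≠ 0 := by
      rw [hm2]
      exact mul_ne_zero hb0 hφ
    exact_mod_cast this
  refine ⟨fun i => (m (Sum.inr q₀)).sign * m (Sum.inl i),
    fun q => (m (Sum.inr q₀)).sign * m (Sum.inr q), ?_, ?_, ?_⟩
  · intro σ f x hx
    have h := congrArg φ (hv σ f x hx)
    simp only [arcWeight, map_add, map_sum] at h ⊢
    have h' : (m (Sum.inl (σ, x)) : ℚ) + ∑ p : QuadType with p.1 f = x, (m (Sum.inr (σ, p)) : ℚ) =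
        m (Sum.inl (G.nbr σ f, G.perm σ f x)) +
        ∑ p : QuadType with p.1 (G.perm σ f f) = G.perm σ f x,
          (m (Sum.inr (G.nbr σ f, p)) : ℚ) := by
      simp only [hm1, hm2, ← Finset.mul_sum, ← mul_add, h]
    have h'' : (m (Sum.inl (σ, x)) : ℝ) + ∑ p : QuadType with p.1 f = x, (m (Sum.inr (σ, p)) : ℝ) =
        m (Sum.inl (G.nbr σ f, G.perm σ f x)) +
        ∑ p : QuadType with p.1 (G.perm σ f f) = G.perm σ f x,
          (m (Sum.inr (G.nbr σ f, p)) : ℝ) := by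
      exact_mod_cast h'
    simp only [Int.cast_mul, ← Finset.mul_sum, ← mul_add, h'']
  · change 0 < (m (Sum.inr q₀)).sign * m (Sum.inr q₀)
    rw [Int.sign_mul_self_eq_abs]
    exact abs_pos.2 hne
  · intro q hq
    have : (m (Sum.inr q) : ℚ) = 0 := by rw [hm2, hq]; simp
    have : m (Sum.inr q) = 0 := by exact_mod_cast this
    simp [this]

theorem twoAngleRigid_iff : G.TwoAngleRigid ↔
    ∃ v ∈ G.normalSurfaceSpace,
      (∀ t : T × Fin 4, ∃ n : ℤ, v.1 t = n) ∧ (∀ q : T × QuadType, ∃ n : ℤ, v.2 q = n) ∧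
      v.2 ≠ 0 ∧ {q : T × QuadType | v.2 q ≠ 0}.ncard ≤ 2 := by
  classical
  constructor
  · rintro ⟨c₁, c₂, hc, q₁, q₂, hq, h⟩
    obtain ⟨v, hv, hvu⟩ := (forall_mem_TAS_iff_exists_mem (G := G)
      (Pi.single q₁ c₁ + Pi.single q₂ c₂)).1 fun x hx => by
        simpa [add_mul, Finset.sum_add_distrib, Pi.single_apply] using h x hx
    have hv12 : v.2 q₁ = c₁ ∧ v.2 q₂ = c₂ := by
      rw [hvu]
      simp [hq, hq.symm]
    have hv0 : ∀ q, q ≠ q₁ → q ≠ q₂ → v.2 q = 0 := fun q h1 h2 => by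
      rw [hvu]
      simp [h1, h2]
    obtain ⟨q₀, hq₀⟩ : ∃ q₀, v.2 q₀ ≠ 0 := by
      by_contra! h0
      exact hc (by rw [← hv12.1, ← hv12.2, h0, h0])
    obtain ⟨t, n, hmem, hpos, hzero⟩ := exists_int_mem hv hq₀
    refine ⟨_, hmem, fun i => ⟨t i, rfl⟩, fun q => ⟨n q, rfl⟩, fun h0 => ?_, ?_⟩
    · have := congrFun h0 q₀
      simp only [Pi.zero_apply, Int.cast_eq_zero] at this
      omega
    · refine (Set.ncard_le_ncard (t := {q₁, q₂}) ?_).trans (Set.ncard_pair hq).le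
      intro q hqn
      by_contra hq'
      simp only [Set.mem_insert_iff, Set.mem_singleton_iff, not_or] at hq'
      exact hqn (by simp [hzero q (hv0 q hq'.1 hq'.2)])
  · rintro ⟨v, hv, -, -, hne, hcard⟩
    have horth := (forall_mem_TAS_iff_exists_mem (G := G) v.2).2 ⟨v, hv, rfl⟩
    obtain ⟨q₁, hq₁⟩ : ∃ q, v.2 q ≠ 0 := by
      by_contra! h0
      exact hne (funext h0)
    -- If only one coordinate is non-zero, the second one may be chosen arbitrarily.
    obtain ⟨q₂, hq₂, hsub⟩ : ∃ q₂, q₁ ≠ q₂ ∧ ∀ q, v.2 q ≠ 0 → q = q₁ ∨ q = q₂ := by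
      by_cases hex : ∃ q₂, q₁ ≠ q₂ ∧ v.2 q₂ ≠ 0
      · obtain ⟨q₂, h12, hq₂⟩ := hex
        refine ⟨q₂, h12, fun q hq => ?_⟩
        by_contra! h
        have : ({q₁, q₂, q} : Set (T × QuadType)).ncard ≤ 2 := by
          refine (Set.ncard_le_ncard ?_).trans hcard
          rintro x (rfl | rfl | rfl) <;> assumption
        rw [Set.ncard_eq_three.2 ⟨q₁, q₂, q, h12, h.1.symm, h.2.symm, rfl⟩] at this
        omega
      · push Not at hex
        obtain ⟨p, hp⟩ : ∃ p, q₁.2 ≠ p := by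
          obtain ⟨c, d, h0c, -, h1c, -⟩ := exists_distinct (q₁.2.apply_ne 0).symm
          obtain ⟨p, hp⟩ := QuadType.exists_apply_eq 0 c h0c.symm
          refine ⟨p, fun h => h1c ?_⟩
          rw [h, hp]
        refine ⟨(q₁.1, p), fun h => hp (congrArg Prod.snd h), fun q hq => Or.inl ?_⟩
        by_contra h
        exact hq (hex q (Ne.symm h))
    refine ⟨v.2 q₁, v.2 q₂, fun h => hq₁ (congrArg Prod.fst h), q₁, q₂, hq₂, fun x hx => ?_⟩
    rw [← horth x hx, Fintype.sum_eq_add q₁ q₂ hq₂]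
    rintro q ⟨h1, h2⟩
    by_contra h
    rcases hsub q (left_ne_zero_of_mul h) with h | h
    exacts [h1 h, h2 h]

end Triangulation

/-! ### Plane sections of the tetrahedron as normal disks -/

/-- The intersection of the tetrahedron with the plane through the origin of barycentric
coordinates that has the coefficients `c`. Signs of `c` tell on which side of the plane the
vertices lie. -/
def planeSection (c : Fin 4 → ℝ) : Set Tetrahedron := {x | ∑ i, c i * x.1 i = 0}

theorem planeSection_neg (c : Fin 4 → ℝ) : planeSection (-c) = planeSection c := by
  ext x
  simp [planeSection]

theorem sum_mul_pos {c : Fin 4 → ℝ} {x : Tetrahedron} (h : ∀ i, x.1 i ≠ 0 → 0 < c i) :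
    0 < ∑ i, c i * x.1 i := by
  obtain ⟨i, hi⟩ : ∃ i, x.1 i ≠ 0 := by
    by_contra! h0
    have := x.2.2
    simp [h0] at this
  refine Finset.sum_pos' (fun j _ => ?_) ⟨i, Finset.mem_univ i, ?_⟩
  · by_cases hj : x.1 j = 0
    · simp [hj]
    · exact mul_nonneg (h j hj).le (x.2.1 j)
  · exact mul_pos (h i hi) (lt_of_le_of_ne (x.2.1 i) (Ne.symm hi))

theorem notMem_planeSection_of_pos {c : Fin 4 → ℝ} {x : Tetrahedron}
    (h : ∀ i, x.1 i ≠ 0 → 0 < c i) : x ∉ planeSection c :=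
  fun hx => (sum_mul_pos h).ne' hx

theorem notMem_planeSection_of_neg {c : Fin 4 → ℝ} {x : Tetrahedron}
    (h : ∀ i, x.1 i ≠ 0 → c i < 0) : x ∉ planeSection c := by
  rw [← planeSection_neg]
  exact notMem_planeSection_of_pos fun i hi => neg_pos.2 (h i hi)

theorem disjoint_planeSection {c d : Fin 4 → ℝ} (h : ∀ i, 0 < c i + d i) :
    Disjoint (planeSection c) (planeSection d) := by
  refine Set.disjoint_left.2 fun x hc hd => ?_
  refine notMem_planeSection_of_pos (c := c + d) (x := x) (fun i _ => h i) ?_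
  change ∑ i, (c + d) i * x.1 i = 0
  simp only [Pi.add_apply, add_mul, Finset.sum_add_distrib]
  rw [show ∑ i, c i * x.1 i = 0 from hc, show ∑ i, d i * x.1 i = 0 from hd, add_zero]

theorem disjoint_planeSection' {c d : Fin 4 → ℝ} (h : ∀ i, d i < c i) :
    Disjoint (planeSection c) (planeSection d) := by
  rw [← planeSection_neg d]
  exact disjoint_planeSection fun i => by simpa using h i

theorem isNormalArc_of_neg {c : Fin 4 → ℝ} {f v w u : Fin 4} (hfv : f ≠ v) (hfw : f ≠ w)
    (hfu : f ≠ u) (hvw : v ≠ w) (hvu : v ≠ u) (hwu : w ≠ u) (hv : c v < 0) (hw : 0 < c w)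
    (hu : 0 < c u) : IsNormalArc f (planeSection c ∩ face f) := by
  -- `(A, 1 - A)` and `(B, 1 - B)` are the coordinates of the end points in the edges at `v`.
  obtain ⟨A, hA0, hA1, hA⟩ : ∃ A, 0 < A ∧ A < 1 ∧ c v * A + c w * (1 - A) = 0 := by
    refine ⟨c w / (c w - c v), div_pos hw (by linarith), (div_lt_one (by linarith)).2 (by linarith),
      ?_⟩
    have : c w - c v ≠ 0 := by linarith
    field_simp
    ring
  obtain ⟨B, hB0, hB1, hB⟩ : ∃ B, 0 < B ∧ B < 1 ∧ c v * B + c u * (1 - B) = 0 := by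
    refine ⟨c u / (c u - c v), div_pos hu (by linarith), (div_lt_one (by linarith)).2 (by linarith),
      ?_⟩
    have : c u - c v ≠ 0 := by linarith
    field_simp
    ring
  have hsum := fun h : Fin 4 → ℝ => sum_fin_four hfv hfw hfu hvw hvu hwu h
  let g : ℝ → Fin 4 → ℝ := fun t i => if i = v then (1 - t) * A + t * B else
    if i = w then (1 - t) * (1 - A) else if i = u then t * (1 - B) else 0
  have gf : ∀ t, g t f = 0 := fun t => by simp [g, hfv, hfw, hfu]
  have gv : ∀ t, g t v = (1 - t) * A + t * B := fun t => by simp [g]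
  have gw : ∀ t, g t w = (1 - t) * (1 - A) := fun t => by simp [g, hvw.symm]
  have gu : ∀ t, g t u = t * (1 - B) := fun t => by simp [g, hvu.symm, hwu.symm]
  have cases := eq_or_eq_of_distinct hfv hfw hfu hvw hvu hwu
  have gmem : ∀ t : unitInterval, g t ∈ stdSimplex ℝ (Fin 4) := by
    intro t
    have h0 := t.2.1
    have h1 := t.2.2
    have h1' : 0 ≤ 1 - (t : ℝ) := by linarith
    have hA1' : 0 ≤ 1 - A := by linarith
    have hB1' : 0 ≤ 1 - B := by linarith
    refine ⟨fun i => ?_, ?_⟩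
    · rcases cases i with rfl | rfl | rfl | rfl
      · rw [gf]
      · rw [gv]; positivity
      · rw [gw]; positivity
      · rw [gu]; positivity
    · rw [hsum, gf, gv, gw, gu]
      ring
  have gcont : Continuous g := by
    refine continuous_pi fun i => ?_
    rcases cases i with rfl | rfl | rfl | rfl
    · simp only [gf]; fun_prop
    · simp only [gv]; fun_prop
    · simp only [gw]; fun_prop
    · simp only [gu]; fun_prop
  have hv0 : ∀ t : unitInterval, g t v ≠ 0 := by
    intro t
    rw [gv]
    have h0 := t.2.1
    have h1 := t.2.2
    rcases eq_or_lt_of_le h0 with h | h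
    · rw [← h]; simpa using hA0.ne'
    · have := mul_pos h hB0
      have := mul_nonneg (sub_nonneg.2 h1) hA0.le
      positivity
  refine ⟨v, w, u, hfv.symm, hfw.symm, hfu.symm, hvw, hvu, hwu,
    ⟨fun t => ⟨g t, gmem t⟩, (gcont.comp continuous_subtype_val).subtype_mk _⟩, ?_, ?_, ?_, ?_, ?_⟩
  · intro s t hst
    have h := congrFun (congrArg Subtype.val hst) u
    change g s u = g t u at h
    rw [gu, gu] at h
    exact Subtype.ext (mul_right_cancel₀ (by linarith) h)
  · ext x
    constructor
    · rintro ⟨t, rfl⟩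
      refine ⟨?_, gf t⟩
      change ∑ i, c i * g t i = 0
      rw [hsum, gf, gv, gw, gu]
      linear_combination (1 - (t : ℝ)) * hA + (t : ℝ) * hB
    · rintro ⟨hx, hxf⟩
      change x.1 f = 0 at hxf
      have h1 : ∑ i, c i * x.1 i = 0 := hx
      have h2 : ∑ i, x.1 i = 1 := x.2.2
      rw [hsum, hxf] at h1 h2
      have hA1' : 0 < 1 - A := by linarith
      have hB1' : 0 < 1 - B := by linarith
      have ht : x.1 u / (1 - B) + x.1 w / (1 - A) = 1 := by
        have e1 : c w = -c v * A / (1 - A) := by field_simp; linarith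
        have e2 : c u = -c v * B / (1 - B) := by field_simp; linarith
        rw [e1, e2] at h1
        have e3 : x.1 v = 1 - x.1 w - x.1 u := by linarith
        rw [e3] at h1
        field_simp at h1 ⊢
        have : c v ≠ 0 := hv.ne
        apply mul_left_cancel₀ this
        linear_combination -h1
      have hw0 : 0 ≤ x.1 w / (1 - A) := div_nonneg (x.2.1 w) hA1'.le
      refine ⟨⟨x.1 u / (1 - B), div_nonneg (x.2.1 u) hB1'.le, by linarith⟩, Subtype.ext ?_⟩
      have hw' : g (x.1 u / (1 - B)) w = x.1 w := by
        rw [gw, show 1 - x.1 u / (1 - B) = x.1 w / (1 - A) by linarith, div_mul_cancel₀ _ hA1'.ne']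
      have hu' : g (x.1 u / (1 - B)) u = x.1 u := by
        rw [gu, div_mul_cancel₀ _ hB1'.ne']
      have hgs : ∑ i, g (x.1 u / (1 - B)) i = 1 := by
        rw [hsum, gf, gv, gw, gu]; ring
      rw [hsum, gf, hw', hu'] at hgs
      funext i
      change g (x.1 u / (1 - B)) i = x.1 i
      rcases cases i with rfl | rfl | rfl | rfl
      · rw [gf, hxf]
      · linarith
      · exact hw'
      · exact hu'
  · intro k
    change g (0 : unitInterval) k ≠ 0 ↔ _
    rcases cases k with rfl | rfl | rfl | rfl
    · simp [gf, hfv, hfw]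
    · simp [gv, hA0.ne']
    · simpa [gw] using by linarith
    · simp [gu, hvu.symm, hwu.symm]
  · intro k
    change g (1 : unitInterval) k ≠ 0 ↔ _
    rcases cases k with rfl | rfl | rfl | rfl
    · simp [gf, hfv, hfu]
    · simp [gv, hB0.ne']
    · simp [gw, hvw.symm, hwu]
    · simpa [gu] using by linarith
  · intro t ht0 ht1 k
    have ht0' : (t : ℝ) ≠ 0 := fun h => ht0 (Subtype.ext h)
    have ht1' : 1 - (t : ℝ) ≠ 0 := fun h => ht1 (Subtype.ext (sub_eq_zero.1 h).symm)
    have hA1' : 1 - A ≠ 0 := by linarith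
    have hB1' : 1 - B ≠ 0 := by linarith
    change g t k = 0 ↔ _
    rcases cases k with rfl | rfl | rfl | rfl
    · simp [gf]
    · simp [hv0, hfv.symm]
    · simp [gw, hfw.symm, ht1', hA1']
    · simp [gu, hfu.symm, ht0', hB1']

theorem isNormalArc_planeSection {c : Fin 4 → ℝ} {f v w u : Fin 4} (hfv : f ≠ v) (hfw : f ≠ w)
    (hfu : f ≠ u) (hvw : v ≠ w) (hvu : v ≠ u) (hwu : w ≠ u) (hw : c v * c w < 0)
    (hu : c v * c u < 0) : IsNormalArc f (planeSection c ∩ face f) := by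
  rcases lt_or_ge (c v) 0 with hv | hv
  · exact isNormalArc_of_neg hfv hfw hfu hvw hvu hwu hv (pos_of_mul_neg_right hw hv.le)
      (pos_of_mul_neg_right hu hv.le)
  · have hw' := neg_of_mul_neg_right hw hv
    have hu' := neg_of_mul_neg_right hu hv
    have hv' := pos_of_mul_neg_left hw hw'.le
    rw [← planeSection_neg]
    exact isNormalArc_of_neg hfv hfw hfu hvw hvu hwu (neg_neg_of_pos hv') (neg_pos.2 hw')
      (neg_pos.2 hu')

/-- A plane that separates two vertices meets the tetrahedron in a properly embedded disk: the
section is a compact convex set with non-empty interior in the plane. -/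
theorem exists_disk_planeSection {c : Fin 4 → ℝ} {i j : Fin 4} (hi : c i < 0) (hj : 0 < c j) :
    ∃ φ : C(Metric.closedBall (0 : EuclideanSpace ℝ (Fin 2)) 1, Tetrahedron),
      Function.Injective φ ∧ Set.range φ = planeSection c ∧
        ∀ p, φ p ∈ boundary ↔ ‖(p : EuclideanSpace ℝ (Fin 2))‖ = 1 := by
  have hij : i ≠ j := by rintro rfl; linarith
  -- An interior point of the tetrahedron in the plane.
  obtain ⟨x₀, hx₀, hx₀s, hx₀c⟩ : ∃ x : Fin 4 → ℝ, (∀ k, 0 < x k) ∧ ∑ k, x k = 1 ∧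
      ∑ k, c k * x k = 0 := by
    obtain ⟨y, hy, hyc⟩ : ∃ y : Fin 4 → ℝ, (∀ k, 0 < y k) ∧ ∑ k, c k * y k = 0 := by
      obtain ⟨k, r, hr, hk⟩ : ∃ k r, 0 ≤ r ∧ ∑ k, c k + c k * r = 0 := by
        rcases le_total (∑ k, c k) 0 with h | h
        · exact ⟨j, -(∑ k, c k) / c j, div_nonneg (by linarith) hj.le, by field_simp; ring⟩
        · refine ⟨i, (∑ k, c k) / (-c i), div_nonneg h (by linarith), ?_⟩
          have := hi.ne
          field_simp
          ring
      refine ⟨fun l => 1 + if l = k then r else 0, fun l => ?_, ?_⟩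
      · dsimp only
        split_ifs <;> linarith
      · simpa [mul_add, Finset.sum_add_distrib] using hk
    have hpos : 0 < ∑ k, y k := Finset.sum_pos (fun k _ => hy k) Finset.univ_nonempty
    refine ⟨fun k => y k / ∑ k, y k, fun k => div_pos (hy k) hpos, ?_, ?_⟩
    · rw [← Finset.sum_div, div_self hpos.ne']
    · simp only [← mul_div_assoc, ← Finset.sum_div, hyc, zero_div]
  -- The direction of the plane, and a linear parametrization of it.
  let S : (Fin 4 → ℝ) →ₗ[ℝ] ℝ := Fintype.linearCombination ℝ fun _ => (1 : ℝ)
  let C : (Fin 4 → ℝ) →ₗ[ℝ] ℝ := Fintype.linearCombination ℝ c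
  have hS : ∀ x, S x = ∑ k, x k := fun x => by simp [S, Fintype.linearCombination_apply]
  have hC : ∀ x, C x = ∑ k, c k * x k := fun x => by
    simp [C, Fintype.linearCombination_apply, mul_comm]
  have hSC : ∀ x, S.prod C x = (S x, C x) := fun _ => rfl
  have hsurj : LinearMap.range (S.prod C) = ⊤ := by
    refine LinearMap.range_eq_top.2 fun ⟨a, b⟩ => ?_
    refine ⟨Pi.single i ((c j * a - b) / (c j - c i)) + Pi.single j ((b - c i * a) / (c j - c i)),
      ?_⟩
    have : c j - c i ≠ 0 := by linarith
    have hS1 : ∀ k r, S (Pi.single k r) = r := fun k r => by simp [hS]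
    have hC1 : ∀ k r, C (Pi.single k r) = c k * r := fun k r => by simp [hC, Pi.single_apply]
    simp only [hSC, map_add, hS1, hC1, Prod.mk.injEq]
    constructor <;> field_simp <;> ring
  let V : Submodule ℝ (Fin 4 → ℝ) := LinearMap.ker (S.prod C)
  have hVrank : Module.finrank ℝ V = 2 := by
    have h := (S.prod C).finrank_range_add_finrank_ker
    rw [hsurj, finrank_top] at h
    simp only [Module.finrank_prod, Module.finrank_self, Module.finrank_fin_fun] at h
    change Module.finrank ℝ (LinearMap.ker (S.prod C)) = 2
    omega
  let e : EuclideanSpace ℝ (Fin 2) ≃L[ℝ] V :=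
    ContinuousLinearEquiv.ofFinrankEq (by rw [hVrank, finrank_euclideanSpace_fin])
  let ψ : EuclideanSpace ℝ (Fin 2) → Fin 4 → ℝ := fun y => x₀ + (e y : Fin 4 → ℝ)
  have hψ : Topology.IsClosedEmbedding ψ :=
    (Homeomorph.addLeft x₀).isClosedEmbedding.comp
      ((Submodule.closed_of_finiteDimensional V).isClosedEmbedding_subtypeVal.comp
        e.toHomeomorph.isClosedEmbedding)
  have heS : ∀ y, ∑ k, (e y : Fin 4 → ℝ) k = 0 ∧ ∑ k, c k * (e y : Fin 4 → ℝ) k = 0 := by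
    intro y
    have h := (e y).2
    rw [LinearMap.mem_ker, hSC, Prod.mk_eq_zero, hS, hC] at h
    exact h
  have hψS : ∀ y, ∑ k, ψ y k = 1 := fun y => by
    simp [ψ, Finset.sum_add_distrib, hx₀s, (heS y).1]
  have hψC : ∀ y, ∑ k, c k * ψ y k = 0 := fun y => by
    simp [ψ, mul_add, Finset.sum_add_distrib, hx₀c, (heS y).2]
  have hψsurj : ∀ x : Fin 4 → ℝ, ∑ k, x k = 1 → ∑ k, c k * x k = 0 → ∃ y, ψ y = x := by
    intro x h1 h2
    have hmem : x - x₀ ∈ V := by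
      rw [LinearMap.mem_ker, hSC, Prod.mk_eq_zero, hS, hC]
      simp [mul_sub, h1, h2, hx₀s, hx₀c]
    exact ⟨e.symm ⟨x - x₀, hmem⟩, by simp [ψ]⟩
  have hψline : ∀ (r : ℝ) y k, ψ ((1 + r) • y) k = (1 + r) * ψ y k - r * x₀ k := by
    intro r y k
    simp only [ψ, map_smul, Pi.add_apply, Submodule.coe_smul, Pi.smul_apply, smul_eq_mul]
    ring
  let K : Set (EuclideanSpace ℝ (Fin 2)) := ψ ⁻¹' stdSimplex ℝ (Fin 4)
  have hKmem : ∀ y, y ∈ K ↔ ∀ k, 0 ≤ ψ y k := fun y => ⟨fun h => h.1, fun h => ⟨h, hψS y⟩⟩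
  have hKcompact : IsCompact K := hψ.isCompact_preimage (isCompact_stdSimplex ℝ (Fin 4))
  have hKconvex : Convex ℝ K := by
    intro y hy z hz a b ha hb hab
    rw [hKmem] at hy hz ⊢
    intro k
    have : ψ (a • y + b • z) k = a * ψ y k + b * ψ z k := by
      simp only [ψ, map_add, map_smul, Pi.add_apply, Submodule.coe_smul, Submodule.coe_add,
        Pi.smul_apply, smul_eq_mul]
      linear_combination (-x₀ k) * hab
    rw [this]
    exact add_nonneg (mul_nonneg ha (hy k)) (mul_nonneg hb (hz k))
  have hcontk : ∀ k, Continuous fun y => ψ y k := fun k => (continuous_apply k).comp hψ.continuous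
  have hKint : interior K = {y | ∀ k, 0 < ψ y k} := by
    refine Set.Subset.antisymm (fun y hy k => ?_) (interior_maximal ?_ ?_)
    · -- Otherwise, moving away from `x₀` through `y` decreases the coordinate `k` below `0`.
      have hev : ∀ᶠ r : ℝ in nhdsWithin 0 (Set.Ioi 0), (1 + r) • y ∈ K := by
        have hc : Filter.Tendsto (fun r : ℝ => (1 + r) • y) (nhds 0) (nhds y) := by
          have : Continuous fun r : ℝ => (1 + r) • y := by fun_prop
          simpa using this.tendsto 0
        exact (hc.eventually (mem_interior_iff_mem_nhds.1 hy)).filter_mono nhdsWithin_le_nhds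
      obtain ⟨r, hr, hr0⟩ := (hev.and self_mem_nhdsWithin).exists
      have hr0 : 0 < r := hr0
      have h := (hKmem _).1 hr k
      rw [hψline] at h
      have := mul_pos hr0 (hx₀ k)
      have h1 : 0 < 1 + r := by linarith [hr0]
      exact pos_of_mul_pos_right (by linarith : 0 < (1 + r) * ψ y k) h1.le
    · intro y hy
      exact (hKmem y).2 fun k => (hy k).le
    · simp only [Set.ofPred_forall]
      exact isOpen_iInter_of_finite fun k => isOpen_lt continuous_const (hcontk k)
  have hKne : (interior K).Nonempty := ⟨0, by rw [hKint]; intro k; simpa [ψ] using hx₀ k⟩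
  obtain ⟨h, -, hcl, hfr⟩ := exists_homeomorph_image_interior_closure_frontier_eq_unitBall
    hKconvex hKne hKcompact.isBounded
  rw [hKcompact.isClosed.closure_eq] at hcl
  have hmem : ∀ p, h.symm p ∈ K ↔ p ∈ Metric.closedBall (0 : EuclideanSpace ℝ (Fin 2)) 1 := by
    intro p
    rw [← hcl, h.image_eq_preimage_symm, Set.mem_preimage (s := K)]
  have hmemfr : ∀ p, h.symm p ∈ frontier K ↔ ‖p‖ = 1 := by
    intro p
    rw [← mem_sphere_zero_iff_norm, ← hfr, h.image_eq_preimage_symm, Set.mem_preimage]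
  refine ⟨⟨fun p => ⟨ψ (h.symm p), (hmem p).2 p.2⟩,
    (hψ.continuous.comp (h.symm.continuous.comp continuous_subtype_val)).subtype_mk _⟩, ?_, ?_, ?_⟩
  · intro p q hpq
    exact Subtype.ext (h.symm.injective (hψ.injective (congrArg Subtype.val hpq)))
  · ext x
    constructor
    · rintro ⟨p, rfl⟩
      exact hψC _
    · intro hx
      obtain ⟨y, hy⟩ := hψsurj x.1 x.2.2 hx
      have hyK : y ∈ K := by
        rw [hKmem, hy]
        exact x.2.1
      refine ⟨⟨h y, (hmem _).1 (by simpa using hyK)⟩, Subtype.ext ?_⟩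
      simpa using hy
  · intro p
    rw [← hmemfr, hKcompact.isClosed.frontier_eq, hKint]
    have hp := (hmem p).2 p.2
    rw [hKmem] at hp
    simp only [boundary, face, Set.mem_iUnion, Set.mem_ofPred_eq, Set.mem_sdiff, not_forall, not_lt,
      hKmem, ContinuousMap.coe_mk]
    constructor
    · rintro ⟨k, hk⟩
      exact ⟨hp, k, hk.le⟩
    · rintro ⟨-, k, hk⟩
      exact ⟨k, le_antisymm hk (hp k)⟩

/-- A plane that separates one vertex from the others cuts out a normal triangle. -/
theorem isNormalTriangle_planeSection {c : Fin 4 → ℝ} {i : Fin 4} (hi : c i < 0)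
    (h : ∀ j, j ≠ i → 0 < c j) : IsNormalTriangle (planeSection c) := by
  obtain ⟨j, hj⟩ := exists_ne i
  refine ⟨exists_disk_planeSection hi (h j hj), {i}ᶜ, by simp [Finset.card_compl], ?_, ?_⟩
  · intro f hf
    have hfi : f ≠ i := by simpa using hf
    obtain ⟨w, u, hfw, hfu, hiw, hiu, hwu⟩ := exists_distinct hfi
    exact isNormalArc_planeSection hfi hfw hfu hiw hiu hwu
      (mul_neg_of_neg_of_pos hi (h w hiw.symm)) (mul_neg_of_neg_of_pos hi (h u hiu.symm))
  · intro f hf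
    obtain rfl : f = i := by simpa using hf
    rw [Set.eq_empty_iff_forall_notMem]
    rintro x ⟨hx, hxf⟩
    refine notMem_planeSection_of_pos (fun k hk => h k ?_) hx
    rintro rfl
    exact hk hxf

/-- A plane that separates the edge `{i, p i}` from the opposite edge cuts out a normal
quadrilateral of type `p`. -/
theorem isNormalQuadOfType_planeSection {c : Fin 4 → ℝ} (p : QuadType)
    (hpos : ∀ i, 0 < c i * c (p.1 i)) (hneg : ∀ i j, j ≠ i → j ≠ p.1 i → c i * c j < 0) :
    IsNormalQuadOfType p (planeSection c) := by
  refine ⟨⟨?_, Finset.univ, by simp, fun f _ => ?_, by simp⟩, fun i => ?_⟩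
  · obtain ⟨j, _, h0j, -, hpj, -, -⟩ := exists_distinct (p.apply_ne 0).symm
    have h := hneg 0 j h0j.symm hpj.symm
    rcases lt_or_ge (c 0) 0 with h0 | h0
    · exact exists_disk_planeSection h0 (pos_of_mul_neg_right h h0.le)
    · have hj := neg_of_mul_neg_right h h0
      exact exists_disk_planeSection hj (pos_of_mul_neg_left h hj.le)
  · have hf := (p.apply_ne f).symm
    obtain ⟨w, u, hfw, hfu, hvw, hvu, hwu⟩ := exists_distinct hf
    exact isNormalArc_planeSection hf hfw hfu hvw hvu hwu
      (hneg _ _ hvw.symm (by rw [p.apply_apply]; exact hfw.symm))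
      (hneg _ _ hvu.symm (by rw [p.apply_apply]; exact hfu.symm))
  · rw [Set.eq_empty_iff_forall_notMem]
    rintro x ⟨hx, hxe⟩
    have hsupp : ∀ k, x.1 k ≠ 0 → k = i ∨ k = p.1 i := by
      intro k hk
      by_contra! h
      exact hk (hxe k h.1 h.2)
    have h := hpos i
    rcases lt_or_ge (c i) 0 with hi | hi
    · refine notMem_planeSection_of_neg (fun k hk => ?_) hx
      rcases hsupp k hk with rfl | rfl
      exacts [hi, neg_of_mul_pos_right h hi.le]
    · have hi' : 0 < c i := lt_of_le_of_ne hi fun h0 => by rw [← h0] at h; simp at h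
      refine notMem_planeSection_of_pos (fun k hk => ?_) hx
      rcases hsupp k hk with rfl | rfl
      exacts [hi', pos_of_mul_pos_right h hi]

/-! ### Intersections of normal disks with faces and edges -/

theorem exists_ne_ne_ne : ∀ f i j : Fin 4, ∃ k, k ≠ f ∧ k ≠ i ∧ k ≠ j := by
  decide

theorem IsNormalArc.nonempty {f : Fin 4} {A : Set Tetrahedron} (h : IsNormalArc f A) :
    A.Nonempty := by
  obtain ⟨v, w, u, -, -, -, -, -, -, γ, -, rfl, -⟩ := h
  exact Set.range_nonempty _

theorem IsNormalPolygon.ncard_faces {n : ℕ} {D : Set Tetrahedron} (h : IsNormalPolygon n D) :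
    {f | (D ∩ face f).Nonempty}.ncard = n := by
  obtain ⟨-, F, hF, h1, h2⟩ := h
  have : {f | (D ∩ face f).Nonempty} = (F : Set (Fin 4)) := by
    ext f
    refine ⟨fun hf => ?_, fun hf => (h1 f hf).nonempty⟩
    by_contra h
    have hf : (D ∩ face f).Nonempty := hf
    rw [h2 f h] at hf
    exact Set.not_nonempty_empty hf
  rw [this, Set.ncard_coe_finset, hF]

theorem IsNormalTriangle.not_isNormalQuadrilateral {D : Set Tetrahedron}
    (h : IsNormalTriangle D) : ¬ IsNormalQuadrilateral D := fun h' => by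
  have := h.ncard_faces.symm.trans h'.ncard_faces
  omega

theorem edge_comm (i j : Fin 4) : edge i j = edge j i := by
  ext x
  exact forall_congr' fun k => forall_comm

theorem edge_subset_face {f i j : Fin 4} (hi : f ≠ i) (hj : f ≠ j) : edge i j ⊆ face f :=
  fun _ hx => hx f hi hj

/-- An arc in the face `f` that cuts off its vertex `v` meets each of the two edges at `v` in one
point, and does not meet the third edge. -/
theorem IsNormalArc.exists_edges {f : Fin 4} {D : Set Tetrahedron}
    (h : IsNormalArc f (D ∩ face f)) : ∃ v w u : Fin 4, f ≠ v ∧ f ≠ w ∧ f ≠ u ∧ v ≠ w ∧ v ≠ u ∧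
      w ≠ u ∧ (D ∩ edge v w).ncard = 1 ∧ (D ∩ edge v u).ncard = 1 ∧ D ∩ edge w u = ∅ := by
  obtain ⟨v, w, u, hv, hw, hu, hvw, hvu, hwu, γ, -, hγ, h0, h1, hint⟩ := h
  have hmem : ∀ t, γ t ∈ D := fun t => by
    have : γ t ∈ D ∩ face f := by rw [← hγ]; exact Set.mem_range_self t
    exact this.1
  have hparam : ∀ i j, f ≠ i → f ≠ j → ∀ x ∈ D ∩ edge i j, ∃ t, γ t = x := by
    rintro i j hi hj x ⟨hxD, hxe⟩
    have : x ∈ D ∩ face f := ⟨hxD, edge_subset_face hi hj hxe⟩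
    rwa [← hγ] at this
  have hend : ∀ i j, f ≠ i → f ≠ j → ∀ x ∈ D ∩ edge i j, x = γ 0 ∨ x = γ 1 := by
    intro i j hi hj x hx
    obtain ⟨t, rfl⟩ := hparam i j hi hj x hx
    by_cases ht0 : t = 0
    · exact Or.inl (by rw [ht0])
    by_cases ht1 : t = 1
    · exact Or.inr (by rw [ht1])
    -- A point of the open face has three non-zero coordinates.
    have ho := hint t ht0 ht1
    obtain ⟨k, hkf, hki, hkj⟩ := exists_ne_ne_ne f i j
    exact absurd ((ho k).1 (hx.2 k hki hkj)) hkf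
  have h0ne : ∀ i j, γ 0 ∈ edge i j → (v = i ∨ v = j) ∧ (w = i ∨ w = j) := by
    intro i j he
    constructor
    · by_contra! hc
      exact (h0 v).2 (Or.inl rfl) (he v hc.1 hc.2)
    · by_contra! hc
      exact (h0 w).2 (Or.inr rfl) (he w hc.1 hc.2)
  have h1ne : ∀ i j, γ 1 ∈ edge i j → (v = i ∨ v = j) ∧ (u = i ∨ u = j) := by
    intro i j he
    constructor
    · by_contra! hc
      exact (h1 v).2 (Or.inl rfl) (he v hc.1 hc.2)
    · by_contra! hc
      exact (h1 u).2 (Or.inr rfl) (he u hc.1 hc.2)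
  have hopen : ∀ {i j : Fin 4} {x : Tetrahedron}, x ∈ openEdge i j → x ∈ edge i j := by
    intro i j x hx k hki hkj
    by_contra hk
    rcases (hx k).1 hk with rfl | rfl
    exacts [hki rfl, hkj rfl]
  refine ⟨v, w, u, hv.symm, hw.symm, hu.symm, hvw, hvu, hwu, ?_, ?_, ?_⟩
  · rw [Set.ncard_eq_one]
    refine ⟨γ 0, Set.Subset.antisymm (fun x hx => ?_) (Set.singleton_subset_iff.2
      ⟨hmem 0, hopen h0⟩)⟩
    rcases hend _ _ hv.symm hw.symm x hx with rfl | rfl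
    · rfl
    · rcases (h1ne _ _ hx.2).2 with h | h
      exacts [absurd h.symm hvu, absurd h.symm hwu]
  · rw [Set.ncard_eq_one]
    refine ⟨γ 1, Set.Subset.antisymm (fun x hx => ?_) (Set.singleton_subset_iff.2
      ⟨hmem 1, hopen h1⟩)⟩
    rcases hend _ _ hv.symm hu.symm x hx with rfl | rfl
    · rcases (h0ne _ _ hx.2).2 with h | h
      exacts [absurd h.symm hvw, absurd h hwu]
    · rfl
  · rw [Set.eq_empty_iff_forall_notMem]
    intro x hx
    rcases hend _ _ hw.symm hu.symm x hx with rfl | rfl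
    · rcases (h0ne _ _ hx.2).1 with h | h
      exacts [hvw h, hvu h]
    · rcases (h1ne _ _ hx.2).1 with h | h
      exacts [hvw h, hvu h]

theorem IsNormalQuadrilateral.isNormalArc {D : Set Tetrahedron} (h : IsNormalQuadrilateral D)
    (f : Fin 4) : IsNormalArc f (D ∩ face f) := by
  obtain ⟨-, F, hF, h1, -⟩ := h
  have : F = Finset.univ := Finset.eq_univ_of_card F (by simp [hF])
  exact h1 f (this ▸ Finset.mem_univ f)

theorem nonempty_of_ncard_eq_one {α : Type*} {s : Set α} (h : s.ncard = 1) : s ≠ ∅ := by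
  rintro rfl
  simp at h

/-- A normal triangle meets exactly the three edges at the vertex that it cuts off, in one point
each. -/
theorem IsNormalTriangle.exists_vertex {D : Set Tetrahedron} (h : IsNormalTriangle D) :
    ∃ i, (∀ j, i ≠ j → (D ∩ edge i j).ncard = 1) ∧ ∀ j k, i ≠ j → i ≠ k → D ∩ edge j k = ∅ := by
  obtain ⟨-, F, hF, h1, h2⟩ := h
  obtain ⟨i, hi⟩ : ∃ i, Fᶜ = {i} := Finset.card_eq_one.1 (by simp [Finset.card_compl, hF])
  have hFi : ∀ f, f ∈ F ↔ f ≠ i := fun f => by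
    rw [← not_iff_not, ← Finset.mem_compl, hi]
    simp
  have hout : ∀ {j k}, i ≠ j → i ≠ k → D ∩ edge j k = ∅ := by
    intro j k hj hk
    refine Set.subset_eq_empty (Set.inter_subset_inter_right D (edge_subset_face hj hk)) (h2 i ?_)
    simp [hFi]
  have hone : ∀ j, i ≠ j → (D ∩ edge i j).ncard = 1 := by
    intro j hij
    obtain ⟨f, _, hif, -, hjf, -, -⟩ := exists_distinct hij
    obtain ⟨v, w, u, hfv, hfw, hfu, hvw, hvu, hwu, hw, hu, -⟩ :=
      (h1 f ((hFi f).2 hif.symm)).exists_edges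
    -- Both edges met by the arc contain `i`, so `i` is the vertex `v` cut off in the face.
    have hiv : i = v := by
      by_contra hiv
      have h3 : i = w := by
        by_contra hiw
        exact nonempty_of_ncard_eq_one hw (hout hiv hiw)
      have h4 : i = u := by
        by_contra hiu
        exact nonempty_of_ncard_eq_one hu (hout hiv hiu)
      exact hwu (h3.symm.trans h4)
    subst hiv
    rcases eq_or_eq_of_distinct hfv hfw hfu hvw hvu hwu j with rfl | rfl | rfl | rfl
    exacts [absurd rfl hjf, absurd rfl hij, hw, hu]
  exact ⟨i, hone, fun _ _ => hout⟩

/-- Exactly one of the three edges met by a normal triangle belongs to a given pair of opposite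
edges. -/
theorem IsNormalTriangle.sum_ncard {D : Set Tetrahedron} (h : IsNormalTriangle D) (p : QuadType) :
    ∑ i, (D ∩ edge i (p.1 i)).ncard = 2 := by
  obtain ⟨i, hone, hout⟩ := h.exists_vertex
  have hip := (p.apply_ne i).symm
  obtain ⟨j, k, hij, hik, hpj, hpk, hjk⟩ := exists_distinct hip
  have hip' : ∀ l, p.1 i ≠ l → i ≠ p.1 l := fun l hl h' => hl (by rw [h', p.apply_apply])
  rw [sum_fin_four hip hij hik hpj hpk hjk, hout _ _ hij (hip' j hpj), hout _ _ hik (hip' k hpk),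
    p.apply_apply, edge_comm (p.1 i) i, hone _ hip]
  simp

/-- A normal quadrilateral misses a pair of opposite edges and meets the other edges in one point
each. -/
theorem IsNormalQuadrilateral.exists_type {D : Set Tetrahedron} (h : IsNormalQuadrilateral D) :
    ∃ p : QuadType, IsNormalQuadOfType p D ∧
      ∀ i j, i ≠ j → p.1 i ≠ j → (D ∩ edge i j).ncard = 1 := by
  have hface : ∀ {a b c f : Fin 4}, f ≠ a → f ≠ b → f ≠ c → a ≠ b → a ≠ c → b ≠ c →
      D ∩ edge a b = ∅ → (D ∩ edge c a).ncard = 1 ∧ (D ∩ edge c b).ncard = 1 := by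
    intro a b c f hfa hfb hfc hab hac hbc he
    obtain ⟨v, w, u, hfv, hfw, hfu, hvw, hvu, hwu, hw, hu, -⟩ := (h.isNormalArc f).exists_edges
    have key : ∀ {i j}, (i = a ∧ j = b ∨ i = b ∧ j = a) → (D ∩ edge i j).ncard ≠ 1 := by
      rintro i j (⟨rfl, rfl⟩ | ⟨rfl, rfl⟩)
      · simp [he]
      · simp [edge_comm i j, he]
    have hvc : v = c := by
      rcases eq_or_eq_of_distinct hfa hfb hfc hab hac hbc v with h1 | h1 | h1 | h1
      · exact absurd h1.symm hfv
      · rcases eq_or_eq_of_distinct hfv hfw hfu hvw hvu hwu b with h2 | h2 | h2 | h2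
        · exact absurd h2.symm hfb
        · exact absurd (h1.symm.trans h2.symm) hab
        · exact absurd hw (key (Or.inl ⟨h1, h2.symm⟩))
        · exact absurd hu (key (Or.inl ⟨h1, h2.symm⟩))
      · rcases eq_or_eq_of_distinct hfv hfw hfu hvw hvu hwu a with h2 | h2 | h2 | h2
        · exact absurd h2.symm hfa
        · exact absurd (h2.trans h1) hab
        · exact absurd hw (key (Or.inr ⟨h1, h2.symm⟩))
        · exact absurd hu (key (Or.inr ⟨h1, h2.symm⟩))
      · exact h1
    subst hvc
    have hmem : ∀ d, f ≠ d → d ≠ v → (D ∩ edge v d).ncard = 1 := by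
      intro d hd hdv
      rcases eq_or_eq_of_distinct hfv hfw hfu hvw hvu hwu d with rfl | rfl | rfl | rfl
      exacts [absurd rfl hd, absurd rfl hdv, hw, hu]
    exact ⟨hmem a hfa hac, hmem b hfb hbc⟩
  -- The missed edge `{w, u}` of the face `f`; its opposite edge is `{v, f}`.
  obtain ⟨f, v, w, u, hfv, hfw, hfu, hvw, hvu, hwu, hw, hu, hE⟩ :
      ∃ f v w u : Fin 4, f ≠ v ∧ f ≠ w ∧ f ≠ u ∧ v ≠ w ∧ v ≠ u ∧ w ≠ u ∧
        (D ∩ edge v w).ncard = 1 ∧ (D ∩ edge v u).ncard = 1 ∧ D ∩ edge w u = ∅ :=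
    ⟨0, (h.isNormalArc 0).exists_edges⟩
  obtain ⟨hf1, hf2⟩ := hface hvw hvu hfv.symm hwu hfw.symm hfu.symm hE
  have hE' : D ∩ edge v f = ∅ := by
    obtain ⟨a, b, c, hua, hub, huc, hab, hac, hbc, ha, hb, hE'⟩ := (h.isNormalArc u).exists_edges
    have hvw' := nonempty_of_ncard_eq_one hw
    have hfw' := nonempty_of_ncard_eq_one hf1
    have hwv' : D ∩ edge w v ≠ ∅ := by rwa [edge_comm]
    have hwf' : D ∩ edge w f ≠ ∅ := by rwa [edge_comm]
    rcases eq_or_eq_of_distinct hfv hfw hfu hvw hvu hwu b with rfl | rfl | rfl | rfl <;>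
    rcases eq_or_eq_of_distinct hfv hfw hfu hvw hvu hwu c with rfl | rfl | rfl | rfl <;>
    first
    | exact absurd rfl hbc
    | exact absurd rfl hub
    | exact absurd rfl huc
    | exact absurd hE' hvw'
    | exact absurd hE' hfw'
    | exact absurd hE' hwv'
    | exact absurd hE' hwf'
    | exact hE'
    | exact edge_comm _ _ ▸ hE'
  obtain ⟨p, hp⟩ := QuadType.exists_apply_eq w u hwu.symm
  have hp' : p.1 u = w := by rw [← hp, p.apply_apply]
  have hpv : p.1 v = f := by
    rcases eq_or_eq_of_distinct hfv hfw hfu hvw hvu hwu (p.1 v) with h1 | h1 | h1 | h1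
    · exact h1
    · exact absurd h1 (p.apply_ne v)
    · exact absurd (p.1.injective (h1.trans hp'.symm)) hvu
    · exact absurd (p.1.injective (h1.trans hp.symm)) hvw
  have hpf : p.1 f = v := by rw [← hpv, p.apply_apply]
  refine ⟨p, ⟨h, fun i => ?_⟩, fun i j hij hpj => ?_⟩
  · rcases eq_or_eq_of_distinct hfv hfw hfu hvw hvu hwu i with rfl | rfl | rfl | rfl
    · rw [hpf, edge_comm, hE']
    · rw [hpv, hE']
    · rw [hp, hE]
    · rw [hp', edge_comm, hE]
  · rcases eq_or_eq_of_distinct hfv hfw hfu hvw hvu hwu i with rfl | rfl | rfl | rfl <;>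
    rcases eq_or_eq_of_distinct hfv hfw hfu hvw hvu hwu j with rfl | rfl | rfl | rfl <;>
    first
    | exact absurd rfl hij
    | exact absurd hpf hpj
    | exact absurd hpv hpj
    | exact absurd hp hpj
    | exact absurd hp' hpj
    | assumption
    | (rw [edge_comm]; assumption)

theorem IsNormalQuadOfType.ncard_eq_one {D : Set Tetrahedron} {p : QuadType}
    (h : IsNormalQuadOfType p D) {i j : Fin 4} (hij : i ≠ j) (hp : p.1 i ≠ j) :
    (D ∩ edge i j).ncard = 1 := by
  obtain ⟨q, -, hq⟩ := h.1.exists_type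
  have : p = q := by
    refine QuadType.eq_of_apply_eq p q 0 ?_
    by_contra hne
    exact nonempty_of_ncard_eq_one (hq 0 (p.1 0) (p.apply_ne 0).symm (Ne.symm hne)) (h.2 0)
  exact hq i j hij (this ▸ hp)

theorem IsNormalDisk.finite_inter_edge {D : Set Tetrahedron} (h : IsNormalDisk D) {i j : Fin 4}
    (hij : i ≠ j) : (D ∩ edge i j).Finite := by
  rcases h with h | h
  · obtain ⟨k, hone, hout⟩ := h.exists_vertex
    by_cases hi : k = i
    · subst hi
      exact Set.finite_of_ncard_ne_zero (by simp [hone j hij])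
    by_cases hj : k = j
    · subst hj
      rw [edge_comm]
      exact Set.finite_of_ncard_ne_zero (by simp [hone i hij.symm])
    · simp [hout i j hi hj]
  · obtain ⟨p, hp, hone⟩ := h.exists_type
    by_cases hpj : p.1 i = j
    · subst hpj
      simp [hp.2]
    · exact Set.finite_of_ncard_ne_zero (by simp [hone i j hij hpj])

theorem IsNormalQuadOfType.eq {D : Set Tetrahedron} {p q : QuadType}
    (hp : IsNormalQuadOfType p D) (hq : IsNormalQuadOfType q D) : p = q := by
  refine QuadType.eq_of_apply_eq p q 0 ?_
  by_contra hne
  exact nonempty_of_ncard_eq_one (hp.ncard_eq_one (q.apply_ne 0).symm hne) (hq.2 0)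

theorem IsNormalQuadOfType.sum_ncard {D : Set Tetrahedron} {q : QuadType}
    (h : IsNormalQuadOfType q D) (p : QuadType) :
    ∑ i, (D ∩ edge i (p.1 i)).ncard = if p = q then 0 else 4 := by
  split_ifs with hpq
  · subst hpq
    simp [h.2]
  · rw [Finset.sum_congr rfl fun i _ => h.ncard_eq_one (p.apply_ne i).symm
      fun h' => hpq (QuadType.eq_of_apply_eq p q i h'.symm)]
    simp

/-! ### The quadrilateral coordinates of an embedded normal surface -/

/-- The affine automorphism of the tetrahedron that permutes the vertices by `g`. -/
noncomputable def relabel (g : Equiv.Perm (Fin 4)) : Tetrahedron ≃ Tetrahedron where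
  toFun x := ⟨fun k => x.1 (g.symm k), fun k => x.2.1 _, by
    rw [Equiv.sum_comp g.symm x.1]
    exact x.2.2⟩
  invFun x := ⟨fun k => x.1 (g k), fun k => x.2.1 _, by
    rw [Equiv.sum_comp g x.1]
    exact x.2.2⟩
  left_inv x := Subtype.ext (funext fun k => congrArg x.1 (g.symm_apply_apply k))
  right_inv x := Subtype.ext (funext fun k => congrArg x.1 (g.apply_symm_apply k))

theorem relabel_apply (g : Equiv.Perm (Fin 4)) (x : Tetrahedron) (k : Fin 4) :
    (relabel g x).1 (g k) = x.1 k := congrArg x.1 (g.symm_apply_apply k)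

namespace Triangulation

variable {T : Type*} {G : Triangulation T}

theorem toSpace_relabel {σ : T} {f : Fin 4} {x : Tetrahedron} (hx : x ∈ face f) :
    G.toSpace (G.nbr σ f) (relabel (G.perm σ f) x) = G.toSpace σ x :=
  (Quot.sound ⟨f, hx, rfl, relabel_apply _ x⟩).symm

namespace EmbeddedNormalSurface

variable (S : G.EmbeddedNormalSurface)

/-- The number of points of a normal surface on an edge of a tetrahedron. -/
noncomputable def edgePoints (a : T × TetEdge) : ℝ :=
  ((G.toSpace a.1 ⁻¹' S.carrier ∩ {x | ∀ k ∉ a.2.1, x.1 k = 0}).ncard : ℝ)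

theorem edgePoints_eq {a b : T × TetEdge} (h : G.EdgeRel a b) :
    S.edgePoints a = S.edgePoints b := by
  obtain ⟨σ, s⟩ := a
  obtain ⟨τ, s'⟩ := b
  obtain ⟨f, hf, h1, h2⟩ := h
  dsimp only at hf h1 h2
  subst h1 h2
  unfold edgePoints
  rw [← Set.ncard_image_of_injective _ (relabel (G.perm σ f)).injective]
  congr 2
  ext y
  obtain ⟨x, rfl⟩ := (relabel (G.perm σ f)).surjective y
  have hsupp : (∀ k ∉ (s.map (G.perm σ f)).1, (relabel (G.perm σ f) x).1 k = 0) ↔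
      ∀ k ∉ s.1, x.1 k = 0 := by
    refine ⟨fun h k hk => ?_, fun h k hk => ?_⟩
    · rw [← relabel_apply (G.perm σ f) x k]
      exact h _ (by simpa [TetEdge.map] using hk)
    · obtain ⟨k, rfl⟩ := (G.perm σ f).surjective k
      rw [relabel_apply]
      exact h k (by simpa [TetEdge.map] using hk)
  rw [(relabel (G.perm σ f)).injective.mem_set_image]
  change (G.toSpace σ x ∈ S.carrier ∧ ∀ k ∉ s.1, x.1 k = 0) ↔
    (G.toSpace (G.nbr σ f) (relabel (G.perm σ f) x) ∈ S.carrier ∧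
      ∀ k ∉ (s.map (G.perm σ f)).1, (relabel (G.perm σ f) x).1 k = 0)
  rw [hsupp]
  refine and_congr_left fun h => ?_
  rw [toSpace_relabel (h f hf)]

/-- The number of points of a normal surface on an edge of the triangulation. -/
noncomputable def edgeWeight : G.Edge → ℝ := Quot.lift S.edgePoints fun _ _ => S.edgePoints_eq

theorem edgeLift_edgeWeight (σ : T) {i j : Fin 4} (hij : i ≠ j) :
    G.edgeLift S.edgeWeight σ {i, j} =
      ∑ D ∈ (S.finite_disks σ).toFinset, ((D ∩ edge i j).ncard : ℝ) := by
  refine (dif_pos (Finset.card_pair hij)).trans ?_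
  change S.edgePoints _ = _
  unfold edgePoints
  have hedge : {x : Tetrahedron | ∀ k ∉ ({i, j} : Finset (Fin 4)), x.1 k = 0} = edge i j := by
    ext x
    simp [edge]
  dsimp only
  rw [hedge, ← S.sUnion_disks, Set.sUnion_eq_biUnion, Set.iUnion₂_inter,
    (S.finite_disks σ).ncard_biUnion fun D hD =>
      (S.isNormalDisk σ D hD).finite_inter_edge hij,
    finsum_mem_eq_finite_toFinset_sum _ (S.finite_disks σ), Nat.cast_sum]
  exact (S.pairwise_disjoint σ).mono fun D => Set.inter_subset_left

open Classical in
/-- The numbers of quadrilaterals of each type in a normal surface are `quadCoord w c`, where `w`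
counts the points on the edges: in every tetrahedron, the number of points on a pair of opposite
edges is the number of triangles plus twice the number of quadrilaterals of the two types that
meet these edges. -/
theorem exists_quadCoord_edgeWeight : ∃ c, ∀ q, G.quadCoord S.edgeWeight c q =
    ∑ D ∈ (S.finite_disks q.1).toFinset, if IsNormalQuadOfType q.2 D then 1 else 0 := by
  refine ⟨fun σ => ∑ D ∈ (S.finite_disks σ).toFinset, if IsNormalTriangle D then 1 / 2 else 1,
    fun ⟨σ, p⟩ => ?_⟩
  rw [quadCoord]
  dsimp only
  rw [Finset.sum_congr rfl fun i _ => S.edgeLift_edgeWeight σ (p.apply_ne i).symm,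
    Finset.sum_comm, Finset.sum_div, ← Finset.sum_sub_distrib]
  refine Finset.sum_congr rfl fun D hD => ?_
  rw [← Nat.cast_sum]
  rcases S.isNormalDisk σ D ((Set.Finite.mem_toFinset _).1 hD) with h | h
  · rw [h.sum_ncard, if_pos h, if_neg fun h' => h.not_isNormalQuadrilateral h'.1]
    norm_num
  · obtain ⟨q, hq, -⟩ := h.exists_type
    rw [hq.sum_ncard, if_neg fun h' : IsNormalTriangle D => h'.not_isNormalQuadrilateral h]
    by_cases hpq : p = q
    · subst hpq
      simp [hq]
    · rw [if_neg hpq, if_neg fun h' => hpq (h'.eq hq)]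
      norm_num

theorem angleRigid_of_quadTypes_eq [Fintype T] {q : T × QuadType} (h : S.quadTypes = {q}) :
    G.AngleRigid := by
  classical
  refine ⟨q, fun x hx => ?_⟩
  obtain ⟨c, hc⟩ := S.exists_quadCoord_edgeWeight
  have horth := (forall_mem_TAS_iff _).2 ⟨S.edgeWeight, c, rfl⟩ x hx
  have hzero : ∀ q', q' ≠ q → ∀ D ∈ S.disks q'.1, ¬ IsNormalQuadOfType q'.2 D := by
    intro q' hq' D hD hDq
    have : q' ∈ S.quadTypes := ⟨D, hD, hDq⟩
    rw [h] at this
    exact hq' this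
  obtain ⟨D, hD, hDq⟩ : q ∈ S.quadTypes := by
    rw [h]
    exact Set.mem_singleton q
  rw [Fintype.sum_eq_single q] at horth
  · refine (mul_eq_zero.1 horth).resolve_left (ne_of_gt ?_)
    rw [hc]
    refine Finset.sum_pos' (fun D _ => by split_ifs <;> norm_num)
      ⟨D, (Set.Finite.mem_toFinset _).2 hD, ?_⟩
    rw [if_pos hDq]
    exact one_pos
  · intro q' hq'
    rw [hc, Finset.sum_eq_zero, zero_mul]
    intro D hD
    exact if_neg (hzero q' hq' D ((Set.Finite.mem_toFinset _).1 hD))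

end EmbeddedNormalSurface
end Triangulation

/-! ### A standard model of normal disks in a tetrahedron -/

section
set_option maxRecDepth 100000

theorem QuadType.side_apply : ∀ (p : QuadType) (i : Fin 4),
    (p.1 i = 0 ∨ p.1 i = p.1 0) ↔ (i = 0 ∨ i = p.1 0) := by
  decide

theorem QuadType.side_of_ne : ∀ (p : QuadType) (i j : Fin 4), j ≠ i → j ≠ p.1 i →
    ((j = 0 ∨ j = p.1 0) ↔ ¬ (i = 0 ∨ i = p.1 0)) := by
  decide

theorem QuadType.apply_eq_iff_of_distinct : ∀ (p : QuadType) (f v u : Fin 4), f ≠ v → f ≠ u →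
    v ≠ u → (p.1 v = u ↔ ¬ (p.1 f = v ∨ p.1 f = u)) := by
  decide

end

section Model

variable (t : Fin 4 → ℕ) (p : QuadType) (Q : ℕ)

/-- One more than the number of points on the edge `{i, j}`, `i ≠ j`, if there are `t v` triangles
at each vertex `v` and `Q` quadrilaterals of type `p`. This is the number of intervals into which
these points divide the edge. -/
def edgeDivisions (i j : Fin 4) : ℝ := t i + t j + 1 + if p.1 i = j then 0 else Q

/-- The coefficients of the plane through the points that are `k` steps from the vertex `i` on the
three edges at `i`. -/
def triangleCoeff (i : Fin 4) (k : ℕ) : Fin 4 → ℝ := fun j =>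
  if j = i then -k else edgeDivisions t p Q i j - k

/-- The coefficients of the plane of the `m`-th quadrilateral of type `p`, counted from the edge
`{0, p 0}`. -/
def quadCoeff (m : ℕ) : Fin 4 → ℝ := fun j =>
  if j = 0 ∨ j = p.1 0 then -(t j + m) else t j + Q + 1 - m

/-- Plane normal disks, with `t v` triangles at each vertex `v` and `Q` quadrilaterals of type
`p`, that meet all edges in equally spaced points. As the points on an edge are equally spaced,
the corners of each quadrilateral are coplanar. -/
def modelDisks : Set (Set Tetrahedron) :=
  {D | ∃ i k, 1 ≤ k ∧ k ≤ t i ∧ D = planeSection (triangleCoeff t p Q i k)} ∪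
    {D | ∃ m, 1 ≤ m ∧ m ≤ Q ∧ D = planeSection (quadCoeff t p Q m)}

variable {t p Q}

theorem lt_edgeDivisions (i j : Fin 4) : (t i + t j : ℝ) < edgeDivisions t p Q i j := by
  unfold edgeDivisions
  split_ifs
  · linarith
  · linarith [(Nat.cast_nonneg Q : (0 : ℝ) ≤ Q)]

theorem triangleCoeff_self (i : Fin 4) (k : ℕ) : triangleCoeff t p Q i k i = -k := if_pos rfl

theorem triangleCoeff_of_ne {i j : Fin 4} (h : j ≠ i) (k : ℕ) :
    triangleCoeff t p Q i k j = edgeDivisions t p Q i j - k := if_neg h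

theorem isNormalTriangle_triangleCoeff {i : Fin 4} {k : ℕ} (hk : 1 ≤ k) (hki : k ≤ t i) :
    IsNormalTriangle (planeSection (triangleCoeff t p Q i k)) := by
  have hki' : (k : ℝ) ≤ t i := by exact_mod_cast hki
  have hk' : (1 : ℝ) ≤ k := by exact_mod_cast hk
  refine isNormalTriangle_planeSection (i := i) ?_ fun j hj => ?_
  · rw [triangleCoeff_self]
    linarith
  · rw [triangleCoeff_of_ne hj]
    linarith [lt_edgeDivisions (t := t) (p := p) (Q := Q) i j,
      (Nat.cast_nonneg (t j) : (0 : ℝ) ≤ t j)]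

theorem isNormalQuadOfType_quadCoeff {m : ℕ} (hm : 1 ≤ m) (hmQ : m ≤ Q) :
    IsNormalQuadOfType p (planeSection (quadCoeff t p Q m)) := by
  have hm' : (1 : ℝ) ≤ m := by exact_mod_cast hm
  have hmQ' : (m : ℝ) ≤ Q := by exact_mod_cast hmQ
  have hneg : ∀ i, (i = 0 ∨ i = p.1 0) → quadCoeff t p Q m i < 0 := fun i hi => by
    rw [quadCoeff, if_pos hi]
    linarith [(Nat.cast_nonneg (t i) : (0 : ℝ) ≤ t i)]
  have hpos : ∀ i, ¬ (i = 0 ∨ i = p.1 0) → 0 < quadCoeff t p Q m i := fun i hi => by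
    rw [quadCoeff, if_neg hi]
    linarith [(Nat.cast_nonneg (t i) : (0 : ℝ) ≤ t i)]
  refine isNormalQuadOfType_planeSection p (fun i => ?_) fun i j hj hj' => ?_
  · by_cases hi : i = 0 ∨ i = p.1 0
    · exact mul_pos_of_neg_of_neg (hneg _ hi) (hneg _ ((p.side_apply i).2 hi))
    · exact mul_pos (hpos _ hi) (hpos _ (mt (p.side_apply i).1 hi))
  · have hij := p.side_of_ne i j hj hj'
    by_cases hi : i = 0 ∨ i = p.1 0
    · exact mul_neg_of_neg_of_pos (hneg _ hi) (hpos _ fun h => hij.1 h hi)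
    · exact mul_neg_of_pos_of_neg (hpos _ hi) (hneg _ (hij.2 hi))

theorem finite_modelDisks : (modelDisks t p Q).Finite := by
  refine Set.Finite.union ?_ ?_
  · refine (Set.finite_iUnion fun i : Fin 4 => (Set.finite_Iic (t i)).image
      fun k => planeSection (triangleCoeff t p Q i k)).subset ?_
    rintro D ⟨i, k, -, hk, rfl⟩
    exact Set.mem_iUnion.2 ⟨i, k, hk, rfl⟩
  · refine ((Set.finite_Iic Q).image fun m => planeSection (quadCoeff t p Q m)).subset ?_
    rintro D ⟨m, -, hm, rfl⟩
    exact ⟨m, hm, rfl⟩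

theorem isNormalDisk_of_mem_modelDisks {D : Set Tetrahedron} (h : D ∈ modelDisks t p Q) :
    IsNormalDisk D := by
  rcases h with ⟨i, k, hk, hki, rfl⟩ | ⟨m, hm, hmQ, rfl⟩
  · exact Or.inl (isNormalTriangle_triangleCoeff hk hki)
  · exact Or.inr (isNormalQuadOfType_quadCoeff hm hmQ).1

theorem disjoint_triangle_triangle {i j : Fin 4} {k l : ℕ} (hk : k ≤ t i) (hl : l ≤ t j)
    (h : i = j → k < l) : Disjoint (planeSection (triangleCoeff t p Q i k))
      (planeSection (triangleCoeff t p Q j l)) := by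
  have hk' : (k : ℝ) ≤ t i := by exact_mod_cast hk
  have hl' : (l : ℝ) ≤ t j := by exact_mod_cast hl
  have hN := lt_edgeDivisions (t := t) (p := p) (Q := Q)
  have ht : ∀ s, (0 : ℝ) ≤ t s := fun s => Nat.cast_nonneg _
  by_cases hij : i = j
  · subst hij
    have hkl : (k : ℝ) < l := by exact_mod_cast h rfl
    refine disjoint_planeSection' fun s => ?_
    by_cases hs : s = i
    · subst hs
      rw [triangleCoeff_self, triangleCoeff_self]
      linarith
    · rw [triangleCoeff_of_ne hs, triangleCoeff_of_ne hs]
      linarith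
  · refine disjoint_planeSection fun s => ?_
    by_cases hs : s = i
    · subst hs
      rw [triangleCoeff_self, triangleCoeff_of_ne hij]
      linarith [hN j s]
    by_cases hs' : s = j
    · subst hs'
      rw [triangleCoeff_self, triangleCoeff_of_ne (Ne.symm hij)]
      linarith [hN i s]
    · rw [triangleCoeff_of_ne hs, triangleCoeff_of_ne hs']
      linarith [hN i s, hN j s, ht s]

theorem disjoint_triangle_quad {i : Fin 4} {k m : ℕ} (hk : k ≤ t i) (hm : 1 ≤ m) (hmQ : m ≤ Q) :
    Disjoint (planeSection (triangleCoeff t p Q i k)) (planeSection (quadCoeff t p Q m)) := by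
  have hk' : (k : ℝ) ≤ t i := by exact_mod_cast hk
  have hm' : (1 : ℝ) ≤ m := by exact_mod_cast hm
  have hmQ' : (m : ℝ) ≤ Q := by exact_mod_cast hmQ
  have hN := lt_edgeDivisions (t := t) (p := p) (Q := Q)
  have ht : ∀ s, (0 : ℝ) ≤ t s := fun s => Nat.cast_nonneg _
  have hNQ : ∀ s, s ≠ p.1 i → edgeDivisions t p Q i s = t i + t s + 1 + Q := fun s hs => by
    rw [edgeDivisions, if_neg (Ne.symm hs)]
  by_cases hi : i = 0 ∨ i = p.1 0
  · refine disjoint_planeSection' fun s => ?_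
    by_cases hs : s = i
    · subst hs
      rw [triangleCoeff_self, quadCoeff, if_pos hi]
      linarith
    rw [triangleCoeff_of_ne hs, quadCoeff]
    by_cases hs' : s = p.1 i
    · rw [if_pos (by rw [hs']; exact (p.side_apply i).2 hi)]
      linarith [hN i s, ht s]
    · rw [if_neg fun h => (p.side_of_ne i s hs hs').1 h hi, hNQ s hs']
      linarith
  · refine disjoint_planeSection fun s => ?_
    by_cases hs : s = i
    · subst hs
      rw [triangleCoeff_self, quadCoeff, if_neg hi]
      linarith
    rw [triangleCoeff_of_ne hs, quadCoeff]
    by_cases hs' : s = p.1 i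
    · rw [if_neg (by rw [hs']; exact mt (p.side_apply i).1 hi)]
      linarith [hN i s, ht s]
    · rw [if_pos ((p.side_of_ne i s hs hs').2 hi), hNQ s hs']
      linarith

theorem disjoint_quad_quad {m n : ℕ} (h : m < n) :
    Disjoint (planeSection (quadCoeff t p Q m)) (planeSection (quadCoeff t p Q n)) := by
  have h' : (m : ℝ) < n := by exact_mod_cast h
  refine disjoint_planeSection' fun s => ?_
  unfold quadCoeff
  split_ifs <;> linarith

theorem pairwiseDisjoint_modelDisks : (modelDisks t p Q).PairwiseDisjoint id := by
  intro D hD D' hD' hne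
  change Disjoint D D'
  rcases hD with ⟨i, k, hk, hki, rfl⟩ | ⟨m, hm, hmQ, rfl⟩ <;>
  rcases hD' with ⟨j, l, hl, hlj, rfl⟩ | ⟨n, hn, hnQ, rfl⟩
  · by_cases hij : i = j
    · subst hij
      rcases lt_trichotomy k l with h | rfl | h
      · exact disjoint_triangle_triangle hki hlj fun _ => h
      · exact absurd rfl hne
      · exact (disjoint_triangle_triangle hlj hki fun _ => h).symm
    · exact disjoint_triangle_triangle hki hlj fun h => absurd h hij
  · exact disjoint_triangle_quad hki hn hnQ
  · exact (disjoint_triangle_quad hlj hm hmQ).symm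
  · rcases lt_trichotomy m n with h | rfl | h
    · exact disjoint_quad_quad h
    · exact absurd rfl hne
    · exact (disjoint_quad_quad h).symm

end Model

/-! ### Normal arcs of the model in a face -/

/-- The union of the normal arcs in the face `f` that join equally spaced points on its edges, if
there are `a v` arcs that cut off each vertex `v` of the face. -/
def OnArcs (f : Fin 4) (a x : Fin 4 → ℝ) : Prop :=
  ∃ v ≠ f, ∃ k : ℕ, 1 ≤ k ∧ (k : ℝ) ≤ a v ∧ ∑ u with u ≠ f ∧ u ≠ v, (a v + a u + 1) * x u = k

theorem sum_filter_of_distinct {f v w u : Fin 4} (hfv : f ≠ v) (hfw : f ≠ w)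
    (hfu : f ≠ u) (hvw : v ≠ w) (hvu : v ≠ u) (hwu : w ≠ u) (h : Fin 4 → ℝ) :
    ∑ u with u ≠ f ∧ u ≠ v, h u = h w + h u := by
  have : (Finset.univ.filter fun s => s ≠ f ∧ s ≠ v) = {w, u} := by
    ext s
    simp only [Finset.mem_filter, Finset.mem_univ, true_and, Finset.mem_insert,
      Finset.mem_singleton]
    constructor
    · rintro ⟨h1, h2⟩
      rcases eq_or_eq_of_distinct hfv hfw hfu hvw hvu hwu s with h | h | h | h
      exacts [absurd h h1, absurd h h2, Or.inl h, Or.inr h]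
    · rintro (rfl | rfl)
      exacts [⟨hfw.symm, hvw.symm⟩, ⟨hfu.symm, hvu.symm⟩]
  rw [this, Finset.sum_pair hwu]

theorem OnArcs.map {f : Fin 4} {a x a' x' : Fin 4 → ℝ} (h : OnArcs f a x)
    (g : Equiv.Perm (Fin 4)) (ha : ∀ v ≠ f, a' (g v) = a v) (hx : ∀ v, x' (g v) = x v) :
    OnArcs (g f) a' x' := by
  obtain ⟨v, hv, k, hk, hka, hsum⟩ := h
  refine ⟨g v, g.injective.ne hv, k, hk, by rwa [ha v hv], ?_⟩
  rw [← hsum]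
  obtain ⟨w, u, hfw, hfu, hvw, hvu, hwu⟩ := exists_distinct hv.symm
  rw [sum_filter_of_distinct hv.symm hfw hfu hvw hvu hwu,
    sum_filter_of_distinct (g.injective.ne hv.symm) (g.injective.ne hfw) (g.injective.ne hfu)
      (g.injective.ne hvw) (g.injective.ne hvu) (g.injective.ne hwu),
    ha v hv, ha w hfw.symm, ha u hfu.symm, hx, hx]

theorem onArcs_map_iff {f : Fin 4} {a x a' x' : Fin 4 → ℝ} (g : Equiv.Perm (Fin 4))
    (ha : ∀ v ≠ f, a' (g v) = a v) (hx : ∀ v, x' (g v) = x v) :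
    OnArcs (g f) a' x' ↔ OnArcs f a x := by
  refine ⟨fun h => ?_, fun h => h.map g ha hx⟩
  have := h.map g⁻¹ (a' := a) (x' := x) (fun v hv => ?_) (fun v => ?_)
  · simpa using this
  · rw [← ha _ fun h' => hv (by simp [← h'])]
    simp
  · rw [← hx]
    simp

/-- The trace of the model disks on a face depends only on the numbers of arcs in the face. -/
theorem mem_sUnion_modelDisks_iff {t : Fin 4 → ℕ} {p : QuadType} {Q : ℕ} {f : Fin 4}
    {x : Tetrahedron} (hx : x ∈ face f) :
    x ∈ ⋃₀ modelDisks t p Q ↔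
      OnArcs f (fun v => (t v : ℝ) + if p.1 f = v then (Q : ℝ) else 0) x.1 := by
  have hx0 : x.1 f = 0 := hx
  have hN : ∀ {v u : Fin 4}, f ≠ v → f ≠ u → v ≠ u → edgeDivisions t p Q v u =
      (t v + if p.1 f = v then (Q : ℝ) else 0) + (t u + if p.1 f = u then (Q : ℝ) else 0) + 1 := by
    intro v u hfv hfu hvu
    have h1 := p.apply_eq_iff_of_distinct f v u hfv hfu hvu
    by_cases h2 : p.1 f = v
    · rw [edgeDivisions, if_neg fun h => h1.1 h (Or.inl h2), if_pos h2,
        if_neg (by rwa [h2])]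
      ring
    by_cases h3 : p.1 f = u
    · rw [edgeDivisions, if_neg fun h => h1.1 h (Or.inr h3), if_neg h2, if_pos h3]
      ring
    · rw [edgeDivisions, if_pos (h1.2 (by simp [h2, h3])), if_neg h2, if_neg h3]
      ring
  -- The triangles at a vertex `v` of the face.
  have htri : ∀ v k, f ≠ v → (x ∈ planeSection (triangleCoeff t p Q v k) ↔
      ∑ u with u ≠ f ∧ u ≠ v, ((t v + if p.1 f = v then (Q : ℝ) else 0) +
        (t u + if p.1 f = u then (Q : ℝ) else 0) + 1) * x.1 u = k) := by
    intro v k hfv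
    obtain ⟨w, u, hfw, hfu, hvw, hvu, hwu⟩ := exists_distinct hfv
    have hs := x.2.2
    rw [sum_fin_four hfv hfw hfu hvw hvu hwu, hx0] at hs
    change ∑ i, triangleCoeff t p Q v k i * x.1 i = 0 ↔ _
    rw [sum_filter_of_distinct hfv hfw hfu hvw hvu hwu, ← hN hfv hfw hvw, ← hN hfv hfu hvu,
      sum_fin_four hfv hfw hfu hvw hvu hwu, hx0, triangleCoeff_self,
      triangleCoeff_of_ne hvw.symm, triangleCoeff_of_ne hvu.symm]
    constructor <;> intro h
    · linear_combination h + (k : ℝ) * hs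
    · linear_combination h - (k : ℝ) * hs
  -- The quadrilaterals are counted from `v = p f` in the face `f`, or from the opposite edge.
  have hquad : ∀ m k : ℕ, (if f = 0 ∨ f = p.1 0 then k = t (p.1 f) + m
      else k + m = t (p.1 f) + Q + 1) → (x ∈ planeSection (quadCoeff t p Q m) ↔
      ∑ u with u ≠ f ∧ u ≠ p.1 f, ((t (p.1 f) + if p.1 f = p.1 f then (Q : ℝ) else 0) +
        (t u + if p.1 f = u then (Q : ℝ) else 0) + 1) * x.1 u = k) := by
    intro m k hmk
    have hfv : f ≠ p.1 f := (p.apply_ne f).symm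
    generalize hv : p.1 f = v at *
    obtain ⟨w, u, hfw, hfu, hvw, hvu, hwu⟩ := exists_distinct hfv
    have hs := x.2.2
    rw [sum_fin_four hfv hfw hfu hvw hvu hwu, hx0] at hs
    change ∑ i, quadCoeff t p Q m i * x.1 i = 0 ↔ _
    rw [sum_filter_of_distinct hfv hfw hfu hvw hvu hwu,
      sum_fin_four hfv hfw hfu hvw hvu hwu, hx0, if_pos rfl, if_neg hvw, if_neg hvu]
    have hsv := p.side_apply f
    have hsw := p.side_of_ne f w hfw.symm (by rw [hv]; exact hvw.symm)
    have hsu := p.side_of_ne f u hfu.symm (by rw [hv]; exact hvu.symm)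
    rw [hv] at hsv
    by_cases hf : f = 0 ∨ f = p.1 0
    · rw [if_pos hf] at hmk
      have hmk' : (k : ℝ) = t v + m := by exact_mod_cast hmk
      simp only [quadCoeff, if_pos (hsv.2 hf), if_neg fun h => hsw.1 h hf,
        if_neg fun h => hsu.1 h hf]
      constructor <;> intro h
      · linear_combination h + (t v + m : ℝ) * hs - hmk'
      · linear_combination h - (t v + m : ℝ) * hs + hmk'
    · rw [if_neg hf] at hmk
      have hmk' : (k + m : ℝ) = t v + Q + 1 := by exact_mod_cast hmk
      simp only [quadCoeff, if_neg (mt hsv.1 hf), if_pos (hsw.2 hf), if_pos (hsu.2 hf)]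
      constructor <;> intro h
      · linear_combination -h + (t v + Q + 1 - m : ℝ) * hs - hmk'
      · linear_combination -h + (t v + Q + 1 - m : ℝ) * hs - hmk'
  constructor
  · rintro ⟨D, ⟨i, k, hk, hki, rfl⟩ | ⟨m, hm, hmQ, rfl⟩, hxD⟩
    · by_cases hfi : f = i
      · -- The triangles at the opposite vertex do not meet the face.
        subst hfi
        refine absurd hxD (notMem_planeSection_of_pos fun j hj => ?_)
        have hjf : j ≠ f := by rintro rfl; exact hj hx0
        have hki' : (k : ℝ) ≤ t f := by exact_mod_cast hki
        rw [triangleCoeff_of_ne hjf]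
        linarith [lt_edgeDivisions (t := t) (p := p) (Q := Q) f j,
          (Nat.cast_nonneg (t j) : (0 : ℝ) ≤ t j)]
      · refine ⟨i, Ne.symm hfi, k, hk, ?_, (htri i k hfi).1 hxD⟩
        have hki' : (k : ℝ) ≤ t i := by exact_mod_cast hki
        dsimp only
        split_ifs
        · linarith [(Nat.cast_nonneg Q : (0 : ℝ) ≤ Q)]
        · linarith
    · obtain ⟨k, hk, hk1, hkQ⟩ : ∃ k, (if f = 0 ∨ f = p.1 0 then k = t (p.1 f) + m
          else k + m = t (p.1 f) + Q + 1) ∧ 1 ≤ k ∧ k ≤ t (p.1 f) + Q := by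
        by_cases hf : f = 0 ∨ f = p.1 0
        · exact ⟨t (p.1 f) + m, by rw [if_pos hf], by omega, by omega⟩
        · exact ⟨t (p.1 f) + Q + 1 - m, by rw [if_neg hf]; omega, by omega, by omega⟩
      refine ⟨p.1 f, p.apply_ne f, k, hk1, ?_, (hquad m k hk).1 hxD⟩
      dsimp only
      rw [if_pos rfl]
      exact_mod_cast hkQ
  · rintro ⟨v, hv, k, hk, hka, hsum⟩
    dsimp only at hka hsum
    by_cases hkt : k ≤ t v
    · exact ⟨_, Or.inl ⟨v, k, hk, hkt, rfl⟩, (htri v k hv.symm).2 hsum⟩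
    by_cases hpv : p.1 f = v
    · subst hpv
      rw [if_pos rfl] at hka
      have hka' : k ≤ t (p.1 f) + Q := by exact_mod_cast hka
      obtain ⟨m, hm, hm1, hmQ⟩ : ∃ m, (if f = 0 ∨ f = p.1 0 then k = t (p.1 f) + m
          else k + m = t (p.1 f) + Q + 1) ∧ 1 ≤ m ∧ m ≤ Q := by
        by_cases hf : f = 0 ∨ f = p.1 0
        · exact ⟨k - t (p.1 f), by rw [if_pos hf]; omega, by omega, by omega⟩
        · exact ⟨t (p.1 f) + Q + 1 - k, by rw [if_neg hf]; omega, by omega, by omega⟩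
      exact ⟨_, Or.inr ⟨m, hm1, hmQ, rfl⟩, (hquad m k hm).2 hsum⟩
    · rw [if_neg hpv, add_zero] at hka
      exact absurd (by exact_mod_cast hka) hkt

/-! ### Normal surfaces from integral solutions -/

namespace Triangulation

variable {T : Type*} {G : Triangulation T}

/-- A non-negative integral solution with at most one non-zero quadrilateral coordinate `q` is
realized by an embedded normal surface. -/
theorem exists_surface (t : T × Fin 4 → ℕ) (q : T × QuadType) (n : T × QuadType → ℕ)
    (hn : 0 < n q) (hn0 : ∀ q', q' ≠ q → n q' = 0)
    (hmem : ((fun i => (t i : ℝ), fun q => (n q : ℝ)) : (T × Fin 4 → ℝ) × (T × QuadType → ℝ)) ∈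
      G.normalSurfaceSpace) : ∃ S : G.EmbeddedNormalSurface, S.quadTypes = {q} := by
  let disks : T → Set (Set Tetrahedron) := fun σ =>
    modelDisks (fun v => t (σ, v)) q.2 (n (σ, q.2))
  have harc : ∀ σ f v, arcWeight ((fun i => (t i : ℝ), fun q => (n q : ℝ)) :
      (T × Fin 4 → ℝ) × (T × QuadType → ℝ)) σ f v =
        (t (σ, v) : ℝ) + if q.2.1 f = v then (n (σ, q.2) : ℝ) else 0 := by
    intro σ f v
    rw [arcWeight, Finset.sum_filter, Finset.sum_eq_single q.2]
    · intro p _ hp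
      dsimp only
      rw [hn0 (σ, p) fun h => hp (congrArg Prod.snd h)]
      simp
    · simp
  have hrel : ∀ a b, G.PointRel a b → (a.2 ∈ ⋃₀ disks a.1) = (b.2 ∈ ⋃₀ disks b.1) := by
    rintro ⟨σ, x⟩ ⟨τ, y⟩ ⟨f, hx, h1, h2⟩
    dsimp only at hx h1 h2 ⊢
    subst h1
    have hy : y ∈ face (G.perm σ f f) := (h2 f).trans hx
    rw [mem_sUnion_modelDisks_iff hx, mem_sUnion_modelDisks_iff hy]
    refine propext (onArcs_map_iff (G.perm σ f) (fun v hv => ?_) h2).symm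
    rw [← harc, ← harc]
    exact (hmem σ f v hv).symm
  refine ⟨⟨{m | Quot.lift (fun a => a.2 ∈ ⋃₀ disks a.1) hrel m}, disks,
    fun σ => finite_modelDisks, fun σ D hD => isNormalDisk_of_mem_modelDisks hD,
    fun σ => pairwiseDisjoint_modelDisks, fun σ => rfl⟩, ?_⟩
  ext ⟨σ, p⟩
  constructor
  · rintro ⟨D, ⟨i, k, hk, hki, rfl⟩ | ⟨m, hm, hmQ, rfl⟩, hDp⟩
    · exact absurd hDp.1 (isNormalTriangle_triangleCoeff hk hki).not_isNormalQuadrilateral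
    · dsimp only at hDp hmQ
      obtain rfl := hDp.eq (isNormalQuadOfType_quadCoeff hm hmQ)
      by_contra hne
      rw [hn0 _ hne] at hmQ
      omega
  · rintro rfl
    exact ⟨_, Or.inr ⟨1, le_rfl, hn, rfl⟩, isNormalQuadOfType_quadCoeff le_rfl hn⟩

theorem angleRigid_iff [Fintype T] : G.AngleRigid ↔
    ∃ S : G.EmbeddedNormalSurface, ∃ q : T × QuadType, S.quadTypes = {q} := by
  classical
  refine ⟨fun ⟨q, hq⟩ => ?_, fun ⟨S, q, hS⟩ => S.angleRigid_of_quadTypes_eq hS⟩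
  obtain ⟨v, hv, hvq⟩ := (forall_mem_TAS_iff_exists_mem (G := G) (Pi.single q 1)).1 fun x hx => by
    simpa [Pi.single_apply] using hq x hx
  obtain ⟨t, n, hmem, hpos, hzero⟩ := exists_int_mem hv (q₀ := q) (by simp [hvq])
  have hzero' : ∀ q', q' ≠ q → n q' = 0 := fun q' hq' => hzero q' (by simp [hvq, hq'])
  -- Adding the links of all vertices makes the triangle coordinates non-negative.
  let C : ℤ := ∑ i, |t i|
  have ht : ∀ i, 0 ≤ t i + C := fun i => by
    have h1 : |t i| ≤ C := Finset.single_le_sum (f := fun i => |t i|) (fun _ _ => abs_nonneg _)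
      (Finset.mem_univ i)
    linarith [neg_abs_le (t i)]
  have hn : ∀ q', 0 ≤ n q' := fun q' => by
    by_cases h : q' = q
    · rw [h]
      exact hpos.le
    · rw [hzero' q' h]
  have hcastt : ∀ i, (((t i + C).toNat : ℕ) : ℝ) = t i + C := fun i => by
    rw [← Int.cast_natCast, Int.toNat_of_nonneg (ht i), Int.cast_add]
  have hcastn : ∀ q', (((n q').toNat : ℕ) : ℝ) = n q' := fun q' => by
    rw [← Int.cast_natCast, Int.toNat_of_nonneg (hn q')]
  obtain ⟨S, hS⟩ := exists_surface (G := G) (fun i => (t i + C).toNat) q (fun q' => (n q').toNat)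
    (by omega) (fun q' hq' => by simp [hzero' q' hq']) (by
      intro σ f x hx
      have h := hmem σ f x hx
      simp only [arcWeight, hcastt, hcastn] at h ⊢
      linarith)
  exact ⟨S, q, hS⟩

end Triangulation

end NormalSurfaces

theorem corollary2p4 {T : Type*} [Fintype T] (G : NormalSurfaces.Triangulation T) :
    (G.AngleRigid ↔
      ∃ S : G.EmbeddedNormalSurface, ∃ q : T × NormalSurfaces.QuadType, S.quadTypes = {q}) ∧
    (G.TwoAngleRigid ↔
      ∃ v ∈ G.normalSurfaceSpace,
        (∀ t : T × Fin 4, ∃ n : ℤ, v.1 t = n) ∧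
        (∀ q : T × NormalSurfaces.QuadType, ∃ n : ℤ, v.2 q = n) ∧
        v.2 ≠ 0 ∧ {q : T × NormalSurfaces.QuadType | v.2 q ≠ 0}.ncard ≤ 2) :=
  ⟨NormalSurfaces.Triangulation.angleRigid_iff, NormalSurfaces.Triangulation.twoAngleRigid_iff⟩
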